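/- Let $\mu\in\mathbb C$ with $\operatorname{Re}\mu>-1$, let $p>0$ and $\beta>0$ be real, and let $F$ and $G$ be complex-valued functions such that, for every $x>p$, $F(x)=\int_0^\infty e^{-xt}G(t)\,dt$ with absolute convergence (so $G$ is the inverse Laplace transform of $F$). Let $J_\mu$ denote the Bessel function of the first kind and $K_\nu$ the Macdonald function. Assume that the integral $$R=\sqrt{\tfrac2\pi}\;p^{\mu+1/2}\beta^{\mu}\int_0^\infty (t^2+\beta^2)^{-\mu/2-1/4}\,G(t)\,K_{\mu+1/2}\bigl(p\sqrt{t^2+\beta^2}\bigr)\,dt$$ converges absolutely. The integrals $$A=\int_p^\infty (x^2-p^2)^{\mu/2}J_\mu\bigl(\beta\sqrt{x^2-p^2}\bigr)F(x)\,dx,\qquad B=\int_0^\infty \frac{y^{\mu+1}}{\sqrt{y^2+p^2}}\,J_\mu(\beta y)\,F\bigl(\sqrt{y^2+p^2}\bigr)\,dy$$ are understood as improper at infinity: such an integral converges if its integrand is Lebesgue integrable up to every finite upper limit and these truncated integrals have a finite limit as the upper limit tends to $\infty$ (so convergence may be conditional). Then $A$ converges if and only if $B$ converges, and the two values then agree;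 and if they converge, then $$A=B=R .$$ -/

import Mathlib

open Filter Topology MeasureTheory Set

/-- The Bessel function of the first kind `J_μ(z)` of complex order, by its power series
`∑ₙ (-1)ⁿ / (n! Γ(μ+n+1)) (z/2)^(2n+μ)` (principal branch of `(z/2)^μ`). Since `Complex.Gamma` and
`·⁻¹` take the value `0` at the poles of `Γ` and at `0`, terms at poles of `Γ` vanish, as usual. -/
noncomputable def besselJ (μ z : ℂ) : ℂ :=
  (z / 2) ^ μ *
    ∑' n : ℕ, (-1 : ℂ) ^ n / ((n.factorial : ℂ) * Complex.Gamma (μ + n + 1)) * (z / 2) ^ (2 * n)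

/-- The Macdonald function (modified Bessel function of the second kind) `K_ν(x)` of complex order
at `x > 0`, by Schläfli's integral `∫₀^∞ exp(-x cosh u) cosh(ν u) du`. -/
noncomputable def besselK (ν : ℂ) (x : ℝ) : ℂ :=
  ∫ u in Ioi (0 : ℝ), (Real.exp (-(x * Real.cosh u)) : ℂ) * Complex.cosh (ν * u)

/-- `I` is the value of the (at infinity possibly only conditionally convergent) integral of `f`
over `(a, ∞)`: `f` is Lebesgue integrable on `(a, b]` for every `b > a`, and
`∫ₐᵇ f → I` as `b → ∞`. -/
def HasImproperIntegral (f : ℝ → ℂ) (a : ℝ) (I : ℂ) : Prop :=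
  (∀ b : ℝ, a < b → IntegrableOn f (Ioc a b) volume) ∧
    Tendsto (fun b : ℝ => ∫ x in a..b, f x) atTop (𝓝 I)

/-- On `(p, ∞)` the function `F` is the (absolutely convergent) Laplace transform of `G`, that is,
`F x = ∫₀^∞ exp(-x t) G(t) dt` for all `x > p`. -/
def IsLaplaceTransformOn (F G : ℝ → ℂ) (p : ℝ) : Prop :=
  ∀ x : ℝ, p < x →
    IntegrableOn (fun t : ℝ => (Real.exp (-(x * t)) : ℂ) * G t) (Ioi 0) volume ∧
      F x = ∫ t in Ioi (0 : ℝ), (Real.exp (-(x * t)) : ℂ) * G t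

/-- The integrand `(x² - p²)^{μ/2} J_μ(β √(x² - p²)) F(x)`. -/
noncomputable def xIntegrand (μ : ℂ) (p β : ℝ) (F : ℝ → ℂ) (x : ℝ) : ℂ :=
  ((x ^ 2 - p ^ 2 : ℝ) : ℂ) ^ (μ / 2) * besselJ μ ((β * √(x ^ 2 - p ^ 2) : ℝ) : ℂ) * F x

/-- The integrand `y^{μ+1} / √(y² + p²) · J_μ(β y) F(√(y² + p²))`. -/
noncomputable def yIntegrand (μ : ℂ) (p β : ℝ) (F : ℝ → ℂ) (y : ℝ) : ℂ :=
  (y : ℂ) ^ (μ + 1) / ((√(y ^ 2 + p ^ 2) : ℝ) : ℂ) * besselJ μ ((β * y : ℝ) : ℂ) *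
    F (√(y ^ 2 + p ^ 2))

/-- The integrand `(t² + β²)^{-μ/2-1/4} G(t) K_{μ+1/2}(p √(t² + β²))`. -/
noncomputable def tIntegrand (μ : ℂ) (p β : ℝ) (G : ℝ → ℂ) (t : ℝ) : ℂ :=
  ((t ^ 2 + β ^ 2 : ℝ) : ℂ) ^ (-μ / 2 - 1 / 4) * G t * besselK (μ + 1 / 2) (p * √(t ^ 2 + β ^ 2))

/-! The equivalence of A and B, with equal values, is the substitution x = √(y² + p²), which carries
truncations to truncations (`hasImproperIntegral_xIntegrand_iff`). The work is in A = R, where A may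
converge only conditionally, so F cannot simply be replaced by its Laplace integral and the order of
integration exchanged.

Let W be the weight multiplying F in A. Insert the damping factor exp(-xε) with ε > 0. If A
converges, Abel's theorem (`HasImproperIntegral.tendsto_integral_mul_exp`) recovers A from the
damped integrals as ε → 0+. For fixed ε Fubini applies and gives ∫ L(t + ε) G(t) dt, where L(s) =
∫ₚ^∞ W(x) exp(-xs) dx. Dominated convergence then yields ∫ L(t) G(t) dt.

Closed form of L (`integral_besselWeight_mul_exp`): put v = x² - p² and write exp(-s√(p²+v))/√(p²+v)
as an integral over u of exponentials linear in v. The v-integral becomes the elementary Laplace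
transform of the Bessel series, and the remaining u-integral is a Macdonald function of order μ +
1/2. Hence L·G is a constant times the integrand of R.

Domination, both for Fubini and for the limit, has to come from the integrability of L·G alone. For
large t it does, because |W| has Laplace transform at most C|L(t)|
(`exists_laplace_norm_besselWeight_le`): Watson's lemma shows that L(t) has exact order t^(-Re μ -
1) exp(-pt), which is also the order of the transform of |W|. On a bounded range of t, local
integrability of G suffices. -/

/-! ### Power series of the Bessel function -/

/-- The entire function `∑ₙ (-1)ⁿ zⁿ / (n! Γ(μ+n+1))`, so that
`J_μ(x) = (x/2)^μ besselSeries μ (x²/4)`. -/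
noncomputable def besselSeries (μ z : ℂ) : ℂ :=
  ∑' n : ℕ, (-1 : ℂ) ^ n / ((n.factorial : ℂ) * Complex.Gamma (μ + n + 1)) * z ^ n

theorem besselJ_eq_besselSeries (μ z : ℂ) :
    besselJ μ z = (z / 2) ^ μ * besselSeries μ ((z / 2) ^ 2) := by
  simp only [besselJ, besselSeries, pow_mul]

theorem Gamma_add_nat_ne_zero {μ : ℂ} (hμ : -1 < μ.re) (n : ℕ) :
    Complex.Gamma (μ + n + 1) ≠ 0 := by
  apply Complex.Gamma_ne_zero_of_re_pos
  simp only [Complex.add_re, Complex.natCast_re, Complex.one_re]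
  have : (0 : ℝ) ≤ n := n.cast_nonneg
  linarith

theorem Gamma_add_nat_succ {μ : ℂ} (hμ : -1 < μ.re) (n : ℕ) :
    Complex.Gamma (μ + (n + 1 : ℕ) + 1) = (μ + n + 1) * Complex.Gamma (μ + n + 1) := by
  rw [← Complex.Gamma_add_one]
  · push_cast; ring_nf
  · intro h
    have := congrArg Complex.re h
    simp only [Complex.add_re, Complex.natCast_re, Complex.one_re, Complex.zero_re] at this
    have : (0 : ℝ) ≤ n := n.cast_nonneg
    linarith

theorem re_add_nat_le_norm (μ : ℂ) (n : ℕ) : μ.re + n + 1 ≤ ‖μ + n + 1‖ := by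
  have := Complex.re_le_norm (μ + n + 1)
  simpa using this

/-- From n = 1 on, each step multiplies Γ by a factor of modulus at least 1, so the reciprocals
decrease. The step from 0 to 1 has the factor μ + 1, which may be small; hence the maximum of two
values. -/
theorem exists_norm_Gamma_inv_le {μ : ℂ} (hμ : -1 < μ.re) :
    ∃ C : ℝ, 0 < C ∧ ∀ n : ℕ, ‖Complex.Gamma (μ + n + 1)‖⁻¹ ≤ C := by
  refine ⟨max ‖Complex.Gamma (μ + (0 : ℕ) + 1)‖⁻¹ ‖Complex.Gamma (μ + (1 : ℕ) + 1)‖⁻¹,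
    lt_max_of_lt_left (inv_pos.2 (norm_pos_iff.2 (Gamma_add_nat_ne_zero hμ 0))), ?_⟩
  intro n
  rcases n with _ | n
  · exact le_max_left _ _
  · refine le_trans ?_ (le_max_right _ _)
    induction n with
    | zero => simp
    | succ k ih =>
      refine le_trans ?_ ih
      rw [Gamma_add_nat_succ hμ (k + 1), norm_mul]
      have h1 := norm_pos_iff.2 (Gamma_add_nat_ne_zero hμ (k + 1))
      have h2 := re_add_nat_le_norm μ (k + 1)
      have : (0 : ℝ) ≤ k := k.cast_nonneg
      push_cast at h2
      apply inv_anti₀ h1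
      push_cast at h1 ⊢
      nlinarith

/-- The quotient of the two Gamma values does not increase with n, since Re z ≤ |z| for the factor
gained at each step. It controls the L¹ norms in the termwise Laplace transform. -/
theorem Gamma_re_le_mul_norm_Gamma {μ : ℂ} (hμ : -1 < μ.re) (n : ℕ) :
    Real.Gamma (μ.re + n + 1) ≤
      Real.Gamma (μ.re + 1) / ‖Complex.Gamma (μ + 1)‖ * ‖Complex.Gamma (μ + n + 1)‖ := by
  induction n with
  | zero =>
    have := norm_pos_iff.2 (Gamma_add_nat_ne_zero hμ 0)
    simp only [Nat.cast_zero, add_zero] at this ⊢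
    rw [div_mul_cancel₀ _ this.ne']
  | succ k ih =>
    have hk : (0 : ℝ) ≤ k := k.cast_nonneg
    have h3 : 0 < μ.re + k + 1 := by linarith
    rw [Gamma_add_nat_succ hμ k, norm_mul]
    have h1 : Real.Gamma (μ.re + (k + 1 : ℕ) + 1)
        = (μ.re + k + 1) * Real.Gamma (μ.re + k + 1) := by
      rw [← Real.Gamma_add_one h3.ne']; push_cast; ring_nf
    rw [h1]
    calc _ ≤ ‖μ + k + 1‖ * Real.Gamma (μ.re + k + 1) :=
          mul_le_mul_of_nonneg_right (re_add_nat_le_norm μ k) (Real.Gamma_pos_of_pos h3).le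
      _ ≤ ‖μ + k + 1‖ * _ := mul_le_mul_of_nonneg_left ih (norm_nonneg _)
      _ = _ := by ring

theorem exists_norm_besselSeries_term_le {μ : ℂ} (hμ : -1 < μ.re) :
    ∃ C : ℝ, 0 < C ∧ ∀ (n : ℕ) (z : ℂ),
      ‖(-1 : ℂ) ^ n / ((n.factorial : ℂ) * Complex.Gamma (μ + n + 1)) * z ^ n‖
        ≤ C * (‖z‖ ^ n / n.factorial) := by
  obtain ⟨C, hC, h⟩ := exists_norm_Gamma_inv_le hμ
  refine ⟨C, hC, fun n z => ?_⟩
  have := mul_le_mul_of_nonneg_right (h n) (by positivity : 0 ≤ ‖z‖ ^ n / n.factorial)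
  refine le_of_eq_of_le ?_ this
  simp only [norm_mul, norm_div, norm_pow, norm_neg, norm_one, one_pow, Complex.norm_natCast]
  field_simp

theorem summable_besselSeries {μ : ℂ} (hμ : -1 < μ.re) (z : ℂ) :
    Summable fun n : ℕ =>
      (-1 : ℂ) ^ n / ((n.factorial : ℂ) * Complex.Gamma (μ + n + 1)) * z ^ n := by
  obtain ⟨C, -, h⟩ := exists_norm_besselSeries_term_le hμ
  exact Summable.of_norm_bounded ((Real.summable_pow_div_factorial ‖z‖).mul_left C)
    fun n => h n z

theorem continuous_besselSeries {μ : ℂ} (hμ : -1 < μ.re) : Continuous (besselSeries μ) := by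
  obtain ⟨C, hC, h⟩ := exists_norm_besselSeries_term_le hμ
  rw [continuous_iff_continuousAt]
  intro z
  have : ContinuousOn (besselSeries μ) (Metric.ball 0 (‖z‖ + 1)) := by
    refine continuousOn_tsum (fun n => by fun_prop)
      ((Real.summable_pow_div_factorial (‖z‖ + 1)).mul_left C) fun n x hx => (h n x).trans ?_
    have := (mem_ball_zero_iff.1 hx).le
    gcongr
  exact this.continuousAt (Metric.isOpen_ball.mem_nhds (by simp))

theorem besselSeries_zero (μ : ℂ) : besselSeries μ 0 = (Complex.Gamma (μ + 1))⁻¹ := by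
  rw [besselSeries, tsum_eq_single 0]
  · simp
  · intro n hn; simp [hn]

/-- This is J_μ + J_{μ+2} = (2(μ+1)/x) J_{μ+1} without the powers of x. It carries bounds from
orders μ + 1 and μ + 2 down to μ. -/
theorem besselSeries_recurrence {μ : ℂ} (hμ : -1 < μ.re) (z : ℂ) :
    besselSeries μ z = (μ + 1) * besselSeries (μ + 1) z - z * besselSeries (μ + 2) z := by
  have h1 : -1 < (μ + 1).re := by simp; linarith
  have h2 : -1 < (μ + 2).re := by simp; linarith
  have e0 := (summable_besselSeries hμ z).hasSum
  have e1 := ((summable_besselSeries h1 z).mul_left (μ + 1)).hasSum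
  rw [tsum_mul_left] at e1
  have e3 := e0.sub e1
  have e2 := ((summable_besselSeries h2 z).mul_left (-z)).hasSum
  rw [tsum_mul_left] at e2
  have key : ∀ n : ℕ, (-1 : ℂ) ^ n / ((n.factorial : ℂ) * Complex.Gamma (μ + n + 1)) * z ^ n -
      (μ + 1) * ((-1 : ℂ) ^ n / ((n.factorial : ℂ) * Complex.Gamma (μ + 1 + n + 1)) * z ^ n)
      = n * ((-1 : ℂ) ^ n / ((n.factorial : ℂ) * Complex.Gamma (μ + 1 + n + 1)) * z ^ n) := by
    intro n
    have hs : Complex.Gamma (μ + 1 + n + 1) = (μ + n + 1) * Complex.Gamma (μ + n + 1) := by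
      rw [← Gamma_add_nat_succ hμ n]; push_cast; ring_nf
    have g1 := Gamma_add_nat_ne_zero h1 n
    rw [hs] at g1 ⊢
    have g2 := Gamma_add_nat_ne_zero hμ n
    have g3 := left_ne_zero_of_mul g1
    have g4 : (n.factorial : ℂ) ≠ 0 := by exact_mod_cast n.factorial_ne_zero
    field_simp
    ring
  simp only [key] at e3
  -- The factor n kills the term at 0; after the index shift it cancels against (n+1)!, leaving the
  -- series of order μ + 2.
  rw [← hasSum_nat_add_iff' 1] at e3
  simp only [Finset.sum_range_one, Nat.cast_zero, zero_mul, sub_zero] at e3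
  have e4 := e3.unique (e2.congr_fun ?_)
  · simp only [besselSeries]
    linear_combination e4
  · intro n
    have g4 : (n.factorial : ℂ) ≠ 0 := by exact_mod_cast n.factorial_ne_zero
    have g5 : (n : ℂ) + 1 ≠ 0 := by exact_mod_cast n.succ_ne_zero
    have g2 := Gamma_add_nat_ne_zero h2 n
    have : μ + 1 + (n + 1 : ℕ) + 1 = μ + 2 + n + 1 := by push_cast; ring
    rw [this, Nat.factorial_succ]
    push_cast
    field_simp
    ring

/-! ### Poisson's integral and growth on the positive axis -/

theorem Gamma_nat_add_half_mul_factorial (n : ℕ) :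
    Complex.Gamma (n + 1 / 2) * n.factorial * 4 ^ n =
      (2 * n).factorial * (√Real.pi : ℂ) := by
  have h := Complex.Gamma_mul_Gamma_add_half (n + 1 / 2)
  rw [show ((n : ℂ) + 1 / 2 + 1 / 2) = n + 1 by ring, Complex.Gamma_nat_eq_factorial,
    show (2 * ((n : ℂ) + 1 / 2)) = (2 * n : ℕ) + 1 by push_cast; ring,
    Complex.Gamma_nat_eq_factorial,
    show (1 - ((2 * n : ℕ) + 1) : ℂ) = -((2 * n : ℕ) : ℂ) by ring, Complex.cpow_neg,
    Complex.cpow_natCast, pow_mul] at h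
  rw [h]
  have : (4 : ℂ) ^ n ≠ 0 := pow_ne_zero _ (by norm_num)
  norm_num
  field_simp

/-- Poisson's integral for the Bessel function. -/
theorem besselSeries_poisson {μ : ℂ} (hμ : -1 / 2 < μ.re) {z : ℝ} (hz : 0 ≤ z) :
    √Real.pi * Complex.Gamma (μ + 1 / 2) * besselSeries μ z =
      ∫ w in Ioc (0 : ℝ) 1, ((w : ℂ) ^ ((1 / 2 : ℂ) - 1) * (1 - w) ^ (μ + 1 / 2 - 1)) *
        (Real.cos (2 * √(z * w)) : ℂ) := by
  have hμ' : 0 < (μ + 1 / 2).re := by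
    simp; norm_num at hμ; linarith
  have hint : IntegrableOn (fun w : ℝ => (w : ℂ) ^ ((1 / 2 : ℂ) - 1) * (1 - w) ^ (μ + 1 / 2 - 1))
      (Ioc 0 1) := by
    rw [← intervalIntegrable_iff_integrableOn_Ioc_of_le zero_le_one]
    exact Complex.betaIntegral_convergent (by norm_num) hμ'
  set f : ℝ → ℂ := fun w => (w : ℂ) ^ ((1 / 2 : ℂ) - 1) * (1 - w) ^ (μ + 1 / 2 - 1) with hf
  have hsum : ∀ w : ℝ, HasSum (fun n : ℕ => (-1 : ℝ) ^ n * (2 * √(z * w)) ^ (2 * n) /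
      (2 * n).factorial) (Real.cos (2 * √(z * w))) := fun w => Real.hasSum_cos _
  have hsb : Summable fun n : ℕ => (4 * z) ^ n / (2 * n).factorial := by
    refine Summable.of_nonneg_of_le (fun n => by positivity) (fun n => ?_)
      (Real.summable_pow_div_factorial (4 * z))
    have : n.factorial ≤ (2 * n).factorial := Nat.factorial_le (by omega)
    gcongr
  -- Expand the cosine and integrate termwise: each term is a Beta integral, and the duplication
  -- formula turns its Γ(n + 1/2)/(2n)! into 1/(4ⁿ n!).
  have H := hasSum_integral_of_dominated_convergence
    (μ := volume.restrict (Ioc (0 : ℝ) 1))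
    (F := fun (n : ℕ) w => f w * (((-1 : ℝ) ^ n * (4 * z * w) ^ n / (2 * n).factorial : ℝ) : ℂ))
    (f := fun w => f w * (Real.cos (2 * √(z * w)) : ℂ))
    (fun n w => ‖f w‖ * ((4 * z) ^ n / (2 * n).factorial))
    (fun n => hint.aestronglyMeasurable.mul (by fun_prop))
    (fun n => by
      filter_upwards [ae_restrict_mem measurableSet_Ioc] with w hw
      rw [norm_mul]
      gcongr
      simp only [Complex.norm_real, norm_div, norm_mul, norm_pow, norm_neg, norm_one, one_pow,
        one_mul, Real.norm_natCast]
      have h0 : 0 ≤ 4 * z := by linarith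
      rw [Real.norm_of_nonneg hw.1.le, Real.norm_of_nonneg hz]
      norm_num
      have h1 : 4 * z * w ≤ 4 * z := mul_le_of_le_one_right h0 hw.2
      have h2 : 0 ≤ 4 * z * w := mul_nonneg h0 hw.1.le
      gcongr)
    (by
      filter_upwards with w
      exact hsb.mul_left _)
    (by
      simp only [tsum_mul_left]
      exact hint.norm.mul_const _)
    (by
      filter_upwards [ae_restrict_mem measurableSet_Ioc] with w hw
      refine HasSum.mul_left _ (Complex.hasSum_ofReal.2 ?_)
      convert hsum w using 4 with n
      rw [pow_mul, mul_pow 2, Real.sq_sqrt (mul_nonneg hz hw.1.le)]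
      ring)
  rw [← H.tsum_eq, besselSeries, ← tsum_mul_left]
  congr 1
  ext n
  have hbeta := Complex.Gamma_mul_Gamma_eq_betaIntegral (s := n + 1 / 2) (t := μ + 1 / 2)
    (by simp; positivity) hμ'
  have hI : (∫ w in Ioc (0 : ℝ) 1,
      f w * (((-1 : ℝ) ^ n * (4 * z * w) ^ n / (2 * n).factorial : ℝ) : ℂ)) =
      ((-1) ^ n * (4 * z) ^ n / (2 * n).factorial) *
        Complex.betaIntegral (n + 1 / 2) (μ + 1 / 2) := by
    rw [Complex.betaIntegral, intervalIntegral.integral_of_le zero_le_one, ← integral_const_mul]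
    refine setIntegral_congr_fun measurableSet_Ioc fun w hw => ?_
    have hw0 : (w : ℂ) ≠ 0 := by exact_mod_cast hw.1.ne'
    simp only [hf]
    rw [show (n + 1 / 2 - 1 : ℂ) = (1 / 2 - 1) + n by ring, Complex.cpow_add _ _ hw0,
      Complex.cpow_natCast]
    push_cast
    rw [mul_pow]
    ring
  rw [hI]
  have hG := Gamma_nat_add_half_mul_factorial n
  rw [show (n + 1 / 2 + (μ + 1 / 2) : ℂ) = μ + n + 1 by ring] at hbeta
  have g2 := Gamma_add_nat_ne_zero (by linarith : -1 < μ.re) n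
  have g4 : (n.factorial : ℂ) ≠ 0 := by exact_mod_cast n.factorial_ne_zero
  have g5 : ((2 * n).factorial : ℂ) ≠ 0 := by exact_mod_cast (2 * n).factorial_ne_zero
  rw [mul_pow]
  generalize Complex.betaIntegral (n + 1 / 2) (μ + 1 / 2) = b at *
  generalize Complex.Gamma (μ + 1 / 2) = g at *
  generalize Complex.Gamma (n + 1 / 2) = k at *
  field_simp
  linear_combination (-g * z ^ n) * hG +
    (4 ^ n * z ^ n * n.factorial) * hbeta

theorem exists_norm_besselSeries_le_of_neg_half_lt {μ : ℂ} (hμ : -1 / 2 < μ.re) :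
    ∃ C : ℝ, 0 ≤ C ∧ ∀ z : ℝ, 0 ≤ z → ‖besselSeries μ z‖ ≤ C := by
  have hμ' : 0 < (μ + 1 / 2).re := by
    simp; norm_num at hμ; linarith
  have hpos : 0 < √Real.pi * ‖Complex.Gamma (μ + 1 / 2)‖ :=
    mul_pos (Real.sqrt_pos.2 Real.pi_pos)
      (norm_pos_iff.2 (Complex.Gamma_ne_zero_of_re_pos hμ'))
  have hint : IntegrableOn (fun w : ℝ => (w : ℂ) ^ ((1 / 2 : ℂ) - 1) * (1 - w) ^ (μ + 1 / 2 - 1))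
      (Ioc 0 1) := by
    rw [← intervalIntegrable_iff_integrableOn_Ioc_of_le zero_le_one]
    exact Complex.betaIntegral_convergent (by norm_num) hμ'
  refine ⟨(∫ w in Ioc (0 : ℝ) 1, ‖(w : ℂ) ^ ((1 / 2 : ℂ) - 1) * (1 - w) ^ (μ + 1 / 2 - 1)‖) /
    (√Real.pi * ‖Complex.Gamma (μ + 1 / 2)‖),
    div_nonneg (integral_nonneg fun w => norm_nonneg _) hpos.le, fun z hz => ?_⟩
  rw [le_div_iff₀ hpos]
  have h := congrArg norm (besselSeries_poisson hμ hz)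
  rw [norm_mul, norm_mul, Complex.norm_real, Real.norm_of_nonneg (Real.sqrt_nonneg _)] at h
  rw [mul_comm, h]
  refine norm_integral_le_of_norm_le hint.norm (Eventually.of_forall fun w => ?_)
  rw [norm_mul _ ((Real.cos _ : ℝ) : ℂ), Complex.norm_real]
  exact mul_le_of_le_one_right (norm_nonneg _) (Real.abs_cos_le_one _)

/-- Poisson's integral gives boundedness only for Re μ > -1/2. The recurrence raises the order into
that range at the price of one factor z. -/
theorem exists_norm_besselSeries_le {μ : ℂ} (hμ : -1 < μ.re) :
    ∃ C : ℝ, 0 < C ∧ ∀ z : ℝ, 0 ≤ z → ‖besselSeries μ z‖ ≤ C * (1 + z) := by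
  obtain ⟨C₁, h1, H1⟩ := exists_norm_besselSeries_le_of_neg_half_lt (μ := μ + 1)
    (by simp; linarith)
  obtain ⟨C₂, h2, H2⟩ := exists_norm_besselSeries_le_of_neg_half_lt (μ := μ + 2)
    (by simp; linarith)
  refine ⟨‖μ + 1‖ * C₁ + C₂ + 1, by positivity, fun z hz => ?_⟩
  rw [besselSeries_recurrence hμ]
  refine (norm_sub_le _ _).trans ?_
  rw [norm_mul, norm_mul, Complex.norm_real, Real.norm_of_nonneg hz]
  have a1 := mul_le_mul_of_nonneg_left (H1 z hz) (norm_nonneg (μ + 1))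
  have a2 := mul_le_mul_of_nonneg_left (H2 z hz) hz
  have : 0 ≤ ‖μ + 1‖ * C₁ * z := by positivity
  nlinarith

/-! ### An elementary Laplace transform -/

/-- The Laplace transform of `v ^ μ * besselSeries μ (c v)`. -/
theorem integral_cpow_mul_besselSeries_mul_exp {μ : ℂ} (hμ : -1 < μ.re) {c r : ℝ} (hc : 0 ≤ c)
    (hr : 0 < r) :
    ∫ v in Ioi (0 : ℝ), (v : ℂ) ^ μ * besselSeries μ (c * v : ℝ) * Complex.exp (-(r * v : ℝ)) =
      ((1 / r : ℝ) : ℂ) ^ (μ + 1) * Complex.exp (-(c / r : ℝ)) := by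
  have hre : ∀ n : ℕ, 0 < (μ + n + 1).re := fun n => by
    have : (0 : ℝ) ≤ n := n.cast_nonneg
    simp; linarith
  have hint : ∀ n : ℕ, IntegrableOn (fun v : ℝ => v ^ (μ.re + n) * Real.exp (-(r * v))) (Ioi 0) := by
    intro n
    have := integrableOn_rpow_mul_exp_neg_mul_rpow (p := 1) (s := μ.re + n) (b := r)
      (by have : (0 : ℝ) ≤ n := n.cast_nonneg
          linarith) one_pos hr
    simpa using this
  set F : ℕ → ℝ → ℂ := fun n v =>
    (-1 : ℂ) ^ n * c ^ n / ((n.factorial : ℂ) * Complex.Gamma (μ + n + 1)) *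
      ((v : ℂ) ^ (μ + n) * Complex.exp (-(r * v : ℝ))) with hF
  have hnorm : ∀ (n : ℕ) (v : ℝ), 0 < v → ‖F n v‖ =
      c ^ n / (n.factorial * ‖Complex.Gamma (μ + n + 1)‖) *
        (v ^ (μ.re + n) * Real.exp (-(r * v))) := by
    intro n v hv
    simp only [hF, norm_mul, norm_div, norm_pow, norm_neg, norm_one, one_pow, one_mul,
      Complex.norm_natCast, Complex.norm_real, Complex.norm_cpow_eq_rpow_re_of_pos hv,
      Complex.norm_exp, Real.norm_of_nonneg hc]
    simp
  have hFm : ∀ n, AEStronglyMeasurable (F n) (volume.restrict (Ioi 0)) := fun n =>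
    Measurable.aestronglyMeasurable (by fun_prop)
  have hFi : ∀ n, Integrable (F n) (volume.restrict (Ioi 0)) := by
    intro n
    refine ((hint n).const_mul
      (c ^ n / (n.factorial * ‖Complex.Gamma (μ + n + 1)‖))).mono' (hFm n) ?_
    filter_upwards [ae_restrict_mem measurableSet_Ioi] with v hv
    exact (hnorm n v hv).le
  have hIn : ∀ n, ∫ v in Ioi (0 : ℝ), ‖F n v‖ =
      c ^ n / (n.factorial * ‖Complex.Gamma (μ + n + 1)‖) *
        ((1 / r) ^ (μ.re + n + 1) * Real.Gamma (μ.re + n + 1)) := by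
    intro n
    rw [setIntegral_congr_fun measurableSet_Ioi (fun v hv => hnorm n v hv), integral_const_mul,
      ← Real.integral_rpow_mul_exp_neg_mul_Ioi (by simpa using hre n) hr]
    simp
  -- Taking norms turns Γ(μ+n+1) in the numerator into Γ(Re μ+n+1), which no longer cancels the
  -- denominator; the Gamma comparison bounds the quotient uniformly in n.
  have hsum : Summable fun n => ∫ v in Ioi (0 : ℝ), ‖F n v‖ := by
    simp only [hIn]
    refine Summable.of_nonneg_of_le (fun n => ?_) (fun n => ?_)
      ((Real.summable_pow_div_factorial (c / r)).mul_left
        ((1 / r) ^ (μ.re + 1) * (Real.Gamma (μ.re + 1) / ‖Complex.Gamma (μ + 1)‖)))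
    · have := Real.Gamma_pos_of_pos (by simpa using hre n : 0 < μ.re + n + 1)
      positivity
    · have h1 := Gamma_re_le_mul_norm_Gamma hμ n
      have h2 := norm_pos_iff.2 (Gamma_add_nat_ne_zero hμ n)
      have h3 : (1 / r) ^ (μ.re + n + 1) = (1 / r) ^ (μ.re + 1) * (1 / r) ^ n := by
        rw [← Real.rpow_natCast, ← Real.rpow_add (by positivity)]; ring_nf
      rw [h3]
      calc _ = c ^ n * (1 / r) ^ n / n.factorial * (1 / r) ^ (μ.re + 1) *
            (Real.Gamma (μ.re + n + 1) / ‖Complex.Gamma (μ + n + 1)‖) := by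
            field_simp
        _ ≤ c ^ n * (1 / r) ^ n / n.factorial * (1 / r) ^ (μ.re + 1) *
            (Real.Gamma (μ.re + 1) / ‖Complex.Gamma (μ + 1)‖) := by
            refine mul_le_mul_of_nonneg_left ?_ (by positivity)
            rwa [div_le_iff₀ h2]
        _ = _ := by rw [← mul_pow]; ring
  have H := hasSum_integral_of_summable_integral_norm hFi hsum
  have hval : ∀ n, ∫ v in Ioi (0 : ℝ), F n v =
      ((1 / r : ℝ) : ℂ) ^ (μ + 1) * ((-(c / r : ℝ) : ℂ) ^ n / n.factorial) := by
    intro n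
    have e := Complex.integral_cpow_mul_exp_neg_mul_Ioi (hre n) hr
    simp only [add_sub_cancel_right] at e
    simp only [hF]
    rw [integral_const_mul]
    push_cast
    rw [e]
    have h1r : (1 / (r : ℂ)) ≠ 0 := by
      exact one_div_ne_zero (by exact_mod_cast hr.ne')
    rw [show μ + n + 1 = μ + 1 + n by ring, Complex.cpow_add _ _ h1r, Complex.cpow_natCast]
    have g2 := Gamma_add_nat_ne_zero hμ n
    rw [show μ + n + 1 = μ + 1 + n by ring] at g2
    have g4 : (n.factorial : ℂ) ≠ 0 := by exact_mod_cast n.factorial_ne_zero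
    have hr0 : (r : ℂ) ≠ 0 := by exact_mod_cast hr.ne'
    rw [neg_pow (c / r : ℂ) n]
    rw [div_pow, div_pow]
    field_simp
    simp
  simp only [hval] at H
  have E := (NormedSpace.expSeries_div_hasSum_exp (-(c / r : ℝ) : ℂ)).mul_left
    (((1 / r : ℝ) : ℂ) ^ (μ + 1))
  rw [← Complex.exp_eq_exp_ℂ] at E
  rw [E.unique H]
  refine setIntegral_congr_fun measurableSet_Ioi fun v hv => ?_
  have hv0 : (v : ℂ) ≠ 0 := by exact_mod_cast (ne_of_gt hv)
  simp only [besselSeries, hF]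
  rw [← tsum_mul_left, ← tsum_mul_right]
  congr 1
  ext n
  rw [Complex.cpow_add _ _ hv0, Complex.cpow_natCast]
  push_cast
  rw [mul_pow]
  ring

/-! ### Integrals for the Macdonald function -/

/-- Since exp u + exp(-u) ≥ u²/2, a Gaussian with rate min(a, b)/2 dominates. -/
theorem integrable_exp_neg_mul_exp_add_mul_exp_neg {a b : ℝ} (ha : 0 < a) (hb : 0 < b) (ν : ℂ) :
    Integrable fun u : ℝ =>
      (Real.exp (-(a * Real.exp u + b * Real.exp (-u))) : ℂ) * Complex.exp (ν * u) := by
  have hm : 0 < min a b := lt_min ha hb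
  have h := (integrable_cexp_quadratic' (b := -(min a b / 2 : ℝ))
    (by rw [← Complex.ofReal_neg, Complex.ofReal_re]; linarith) (ν.re : ℂ) 0).norm
  refine h.mono' (Continuous.aestronglyMeasurable (by fun_prop)) (Eventually.of_forall fun u => ?_)
  rw [norm_mul, Complex.norm_real, Real.norm_of_nonneg (Real.exp_pos _).le, Complex.norm_exp,
    Complex.norm_exp, ← Real.exp_add]
  apply Real.exp_le_exp.2
  have h1 : u ^ 2 / 2 ≤ Real.exp u + Real.exp (-u) := by
    rcases le_total 0 u with hu | hu
    · nlinarith [Real.quadratic_le_exp_of_nonneg hu, Real.exp_pos (-u)]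
    · nlinarith [Real.quadratic_le_exp_of_nonneg (neg_nonneg.2 hu), Real.exp_pos u]
  have h4 := mul_le_mul_of_nonneg_left h1 hm.le
  have h2 := mul_le_mul_of_nonneg_right (min_le_left a b) (Real.exp_pos u).le
  have h3 := mul_le_mul_of_nonneg_right (min_le_right a b) (Real.exp_pos (-u)).le
  have e1 : (ν * u).re = ν.re * u := by simp
  have e2 : (-((min a b / 2 : ℝ) : ℂ) * (u : ℂ) ^ 2 + (ν.re : ℂ) * u + 0).re
      = -(min a b / 2) * u ^ 2 + ν.re * u := by
    simp [← Complex.ofReal_pow]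
  rw [e1, e2]
  nlinarith

theorem integral_exp_neg_mul_cosh_mul_exp {x : ℝ} (hx : 0 < x) (ν : ℂ) :
    ∫ u : ℝ, (Real.exp (-(x * Real.cosh u)) : ℂ) * Complex.exp (ν * u) = 2 * besselK ν x := by
  have hint : Integrable fun u : ℝ =>
      (Real.exp (-(x * Real.cosh u)) : ℂ) * Complex.exp (ν * u) := by
    convert integrable_exp_neg_mul_exp_add_mul_exp_neg (half_pos hx) (half_pos hx) ν using 6 with u
    rw [Real.cosh_eq]; ring
  rw [← intervalIntegral.integral_Iic_add_Ioi (b := (0 : ℝ)) hint.integrableOn hint.integrableOn]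
  have h1 := integral_comp_neg_Ioi (0 : ℝ) fun u : ℝ =>
      (Real.exp (-(x * Real.cosh u)) : ℂ) * Complex.exp (ν * u)
  rw [neg_zero] at h1
  rw [← h1, ← integral_add, besselK, ← integral_const_mul]
  · congr 1
    ext u
    rw [Complex.cosh, Real.cosh_neg]
    push_cast
    rw [mul_neg]
    ring
  · exact hint.comp_neg.integrableOn
  · exact hint.integrableOn

/-- Translating u by ½ log(b/a) makes both coefficients equal to √(ab), leaving Schläfli's integral
folded out to the whole line. -/
theorem integral_exp_neg_mul_exp_add_mul_exp_neg {a b : ℝ} (ha : 0 < a) (hb : 0 < b) (ν : ℂ) :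
    ∫ u : ℝ, (Real.exp (-(a * Real.exp u + b * Real.exp (-u))) : ℂ) * Complex.exp (ν * u) =
      2 * ((b / a : ℝ) : ℂ) ^ (ν / 2) * besselK ν (2 * √(a * b)) := by
  have hab : 0 < a * b := mul_pos ha hb
  have hba : 0 < b / a := div_pos hb ha
  set h := Real.log (b / a) / 2 with hh
  have e2 : Real.exp h ^ 2 = b / a := by
    rw [← Real.exp_nat_mul, hh]
    push_cast
    rw [mul_div_cancel₀ _ two_ne_zero, Real.exp_log hba]
  have e1 : a * Real.exp h = √(a * b) := by
    symm
    rw [Real.sqrt_eq_iff_mul_self_eq hab.le (by positivity)]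
    have : a * (b / a) = b := by field_simp
    linear_combination -a ^ 2 * e2 - a * this
  have e3 : b * Real.exp (-h) = √(a * b) := by
    rw [← e1, Real.exp_neg]
    field_simp
    rw [e2]
    field_simp
  rw [← integral_add_right_eq_self _ h, mul_right_comm,
    ← integral_exp_neg_mul_cosh_mul_exp (by positivity), mul_comm, ← integral_const_mul]
  congr 1
  ext u
  have e4 : a * Real.exp (u + h) + b * Real.exp (-(u + h)) = 2 * √(a * b) * Real.cosh u := by
    rw [neg_add, Real.exp_add, Real.exp_add, Real.cosh_eq]
    linear_combination Real.exp u * e1 + Real.exp (-u) * e3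
  have e5 : ((b / a : ℝ) : ℂ) ^ (ν / 2) = Complex.exp (ν * h) := by
    rw [Complex.cpow_def_of_ne_zero (by exact_mod_cast hba.ne'), ← Complex.ofReal_log hba.le, hh]
    congr 1
    push_cast
    ring
  rw [e4, e5]
  push_cast
  rw [mul_add, Complex.exp_add]
  ring

/-- The substitution y = sinh(u/2), with cosh u = 1 + 2 sinh²(u/2), produces a Gaussian integral. -/
theorem besselK_neg_half (x : ℝ) :
    besselK (-1 / 2) x = ((Real.exp (-x) * √(Real.pi / (2 * x)) : ℝ) : ℂ) := by
  have himg : (fun u : ℝ => Real.sinh (u / 2)) '' Ioi 0 = Ioi 0 := by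
    ext y
    constructor
    · rintro ⟨u, hu, rfl⟩
      exact Real.sinh_pos_iff.2 (half_pos hu)
    · intro hy
      exact ⟨2 * Real.arsinh y, mul_pos two_pos (Real.arsinh_pos_iff.2 hy), by simp⟩
  have hinj : InjOn (fun u : ℝ => Real.sinh (u / 2)) (Ioi 0) := fun u _ v _ h => by
    have := Real.sinh_injective h
    linarith
  have hder : ∀ u ∈ Ioi (0 : ℝ), HasDerivWithinAt (fun u : ℝ => Real.sinh (u / 2))
      (Real.cosh (u / 2) / 2) (Ioi 0) u := fun u _ => by
    simpa [div_eq_mul_inv] using ((hasDerivAt_id u).div_const 2).sinh.hasDerivWithinAt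
  have key := integral_image_eq_integral_abs_deriv_smul measurableSet_Ioi hder hinj
    fun y => Real.exp (-(2 * x) * y ^ 2)
  rw [himg, integral_gaussian_Ioi] at key
  have e : ∀ u : ℝ, (Real.exp (-(x * Real.cosh u)) : ℂ) * Complex.cosh (-1 / 2 * u) =
      ((2 * Real.exp (-x) *
        (|Real.cosh (u / 2) / 2| • Real.exp (-(2 * x) * Real.sinh (u / 2) ^ 2)) : ℝ) : ℂ) := by
    intro u
    have h1 : Real.cosh u = 1 + 2 * Real.sinh (u / 2) ^ 2 := by
      have := Real.cosh_two_mul (u / 2)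
      rw [mul_div_cancel₀ _ two_ne_zero, Real.cosh_sq] at this
      linarith
    have h2 : Complex.cosh (-1 / 2 * u) = ((Real.cosh (u / 2) : ℝ) : ℂ) := by
      rw [← Complex.cosh_neg]; push_cast; congr 1; ring
    rw [h2, abs_of_pos (div_pos (Real.cosh_pos _) two_pos), h1, ← Complex.ofReal_mul]
    congr 1
    rw [show -(x * (1 + 2 * Real.sinh (u / 2) ^ 2)) = -x + -(2 * x) * Real.sinh (u / 2) ^ 2 by ring,
      Real.exp_add, smul_eq_mul]
    ring
  rw [besselK]
  simp only [e]
  rw [integral_complex_ofReal, integral_const_mul, ← key]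
  congr 1
  ring

theorem integral_exp_neg_mul_exp_add_mul_exp_neg_half {a b : ℝ} (ha : 0 < a) (hb : 0 < b) :
    ∫ u : ℝ, Real.exp (-(a * Real.exp u + b * Real.exp (-u))) * Real.exp (-u / 2) =
      √(Real.pi / b) * Real.exp (-(2 * √(a * b))) := by
  have h := integral_exp_neg_mul_exp_add_mul_exp_neg ha hb (-1 / 2)
  have hab : 0 < a * b := mul_pos ha hb
  rw [besselK_neg_half, show (-1 / 2 / 2 : ℂ) = ((-1 / 4 : ℝ) : ℂ) by norm_num,
    ← Complex.ofReal_cpow (div_pos hb ha).le] at h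
  apply Complex.ofReal_injective
  rw [← integral_complex_ofReal]
  convert h using 1
  · congr 1
    ext u
    push_cast
    congr 2
    ring
  · have hR : √(Real.pi / b) * Real.exp (-(2 * √(a * b))) = 2 * (b / a) ^ (-1 / 4 : ℝ) *
        (Real.exp (-(2 * √(a * b))) * √(Real.pi / (2 * (2 * √(a * b))))) := ?_
    · rw [hR, Complex.ofReal_mul, Complex.ofReal_mul, Complex.ofReal_ofNat]
    -- Fourth roots of a and b as parameters make every square root and quarter power below
    -- rational.
    obtain ⟨A, hA, rfl⟩ : ∃ A : ℝ, 0 < A ∧ A ^ 4 = a :=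
      ⟨√(√a), by positivity, by
        rw [show 4 = 2 * 2 by norm_num, pow_mul, Real.sq_sqrt (by positivity), Real.sq_sqrt ha.le]⟩
    obtain ⟨B, hB, rfl⟩ : ∃ B : ℝ, 0 < B ∧ B ^ 4 = b :=
      ⟨√(√b), by positivity, by
        rw [show 4 = 2 * 2 by norm_num, pow_mul, Real.sq_sqrt (by positivity), Real.sq_sqrt hb.le]⟩
    have e1 : √(A ^ 4 * B ^ 4) = (A * B) ^ 2 := by
      rw [show A ^ 4 * B ^ 4 = ((A * B) ^ 2) ^ 2 by ring, Real.sqrt_sq (by positivity)]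
    have e2 : √(Real.pi / (2 * (2 * (A * B) ^ 2))) = √Real.pi / (2 * (A * B)) := by
      rw [show 2 * (2 * (A * B) ^ 2) = (2 * (A * B)) ^ 2 by ring, Real.sqrt_div Real.pi_pos.le,
        Real.sqrt_sq (by positivity)]
    have e3 : √(Real.pi / B ^ 4) = √Real.pi / B ^ 2 := by
      rw [show B ^ 4 = (B ^ 2) ^ 2 by ring, Real.sqrt_div Real.pi_pos.le,
        Real.sqrt_sq (by positivity)]
    have e4 : (B ^ 4 / A ^ 4) ^ (-1 / 4 : ℝ) = A / B := by
      rw [← div_pow, ← Real.rpow_natCast, ← Real.rpow_mul (by positivity)]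
      norm_num
      rw [Real.rpow_neg_one, inv_div]
    rw [e1, e2, e3, e4]
    field_simp

/-! ### The Bessel weight and the closed form of its Laplace transform -/

/-- The factor `(x² - p²)^{μ/2} J_μ(β √(x² - p²))` of `xIntegrand`. -/
noncomputable def besselWeight (μ : ℂ) (p β x : ℝ) : ℂ :=
  ((x ^ 2 - p ^ 2 : ℝ) : ℂ) ^ (μ / 2) * besselJ μ ((β * √(x ^ 2 - p ^ 2) : ℝ) : ℂ)

theorem ofReal_sq_cpow_half {r : ℝ} (hr : 0 < r) (μ : ℂ) :
    ((r ^ 2 : ℝ) : ℂ) ^ (μ / 2) = (r : ℂ) ^ μ := by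
  rw [Complex.cpow_def_of_ne_zero (by exact_mod_cast (pow_pos hr 2).ne'),
    Complex.cpow_def_of_ne_zero (by exact_mod_cast hr.ne'), ← Complex.ofReal_log hr.le,
    ← Complex.ofReal_log (by positivity), Real.log_pow]
  congr 1
  push_cast
  ring

theorem sq_sub_sq_pos {p x : ℝ} (hp : 0 < p) (hx : p < x) : 0 < x ^ 2 - p ^ 2 := by
  nlinarith

theorem besselWeight_eq (μ : ℂ) {p β x : ℝ} (hp : 0 < p) (hβ : 0 < β) (hx : p < x) :
    besselWeight μ p β x = ((x ^ 2 - p ^ 2 : ℝ) : ℂ) ^ μ * ((β / 2 : ℝ) : ℂ) ^ μ *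
      besselSeries μ (β ^ 2 / 4 * (x ^ 2 - p ^ 2) : ℝ) := by
  have hw := sq_sub_sq_pos hp hx
  rw [besselWeight, besselJ_eq_besselSeries]
  obtain ⟨r, hr, hrw⟩ : ∃ r : ℝ, 0 < r ∧ r ^ 2 = x ^ 2 - p ^ 2 :=
    ⟨√(x ^ 2 - p ^ 2), Real.sqrt_pos.2 hw, Real.sq_sqrt hw.le⟩
  rw [← hrw, Real.sqrt_sq hr.le, ofReal_sq_cpow_half hr,
    show ((β * r : ℝ) : ℂ) / 2 = ((β / 2 : ℝ) : ℂ) * (r : ℂ) by push_cast; ring,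
    Complex.mul_cpow_ofReal_nonneg (by positivity) hr.le,
    show ((r ^ 2 : ℝ) : ℂ) = (r : ℂ) * (r : ℂ) by push_cast; ring,
    Complex.mul_cpow_ofReal_nonneg hr.le hr.le,
    show (((β / 2 : ℝ) : ℂ) * (r : ℂ)) ^ 2 = ((β ^ 2 / 4 * r ^ 2 : ℝ) : ℂ) by push_cast; ring]
  ring

theorem setIntegral_Ioi_comp_sq_sub_sq {p : ℝ} (hp : 0 < p) (g : ℝ → ℂ) :
    ∫ v in Ioi (0 : ℝ), g v = ∫ x in Ioi p, (2 * x) • g (x ^ 2 - p ^ 2) := by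
  have himg : (fun x : ℝ => x ^ 2 - p ^ 2) '' Ioi p = Ioi 0 := by
    ext v
    constructor
    · rintro ⟨x, hx, rfl⟩
      exact sq_sub_sq_pos hp hx
    · intro hv
      have hv' : 0 < v := hv
      refine ⟨√(v + p ^ 2), Real.lt_sqrt_of_sq_lt (by linarith), ?_⟩
      simp only
      rw [Real.sq_sqrt (by positivity)]
      ring
  have hinj : InjOn (fun x : ℝ => x ^ 2 - p ^ 2) (Ioi p) := fun x hx y hy h => by
    have h' : x ^ 2 = y ^ 2 := by simpa using h
    exact (sq_eq_sq₀ (hp.trans hx).le (hp.trans hy).le).1 h'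
  have hder : ∀ x ∈ Ioi p, HasDerivWithinAt (fun x : ℝ => x ^ 2 - p ^ 2) (2 * x) (Ioi p) x :=
    fun x _ => by simpa using ((hasDerivAt_pow 2 x).sub_const (p ^ 2)).hasDerivWithinAt
  rw [← himg, integral_image_eq_integral_abs_deriv_smul measurableSet_Ioi hder hinj]
  refine setIntegral_congr_fun measurableSet_Ioi fun x hx => ?_
  have : 0 < x := hp.trans hx
  rw [abs_of_pos (by positivity)]

theorem integrableOn_rpow_mul_exp_neg_sqrt {σ s p : ℝ} (hσ : -1 < σ) (hs : 0 < s) (C : ℝ) :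
    IntegrableOn (fun v : ℝ => v ^ σ * (1 + C * v) * Real.exp (-(s * √(p ^ 2 + v)))) (Ioi 0) := by
  have h1 := integrableOn_rpow_mul_exp_neg_mul_rpow (p := 1 / 2) hσ (by norm_num) hs
  have h2 := integrableOn_rpow_mul_exp_neg_mul_rpow (p := 1 / 2) (s := σ + 1) (by linarith)
    (by norm_num) hs
  refine (h1.add (h2.const_mul |C|)).mono' (Measurable.aestronglyMeasurable (by fun_prop)) ?_
  filter_upwards [ae_restrict_mem measurableSet_Ioi] with v hv
  have hv' : 0 < v := hv
  rw [norm_mul, norm_mul, Real.norm_of_nonneg (by positivity : 0 ≤ v ^ σ),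
    Real.norm_of_nonneg (Real.exp_pos _).le]
  have e1 : ‖1 + C * v‖ ≤ 1 + |C| * v := by
    refine (norm_add_le _ _).trans ?_
    rw [norm_mul, norm_one, Real.norm_eq_abs, Real.norm_of_nonneg hv'.le]
  have e2 : Real.exp (-(s * √(p ^ 2 + v))) ≤ Real.exp (-s * v ^ (1 / 2 : ℝ)) := by
    rw [← Real.sqrt_eq_rpow]
    apply Real.exp_le_exp.2
    have := Real.sqrt_le_sqrt (by nlinarith [sq_nonneg p] : v ≤ p ^ 2 + v)
    nlinarith
  calc _ ≤ v ^ σ * (1 + |C| * v) * Real.exp (-s * v ^ (1 / 2 : ℝ)) := by gcongr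
    _ = _ := by
      simp only [Pi.add_apply]
      rw [Real.rpow_add_one hv'.ne']
      ring

/-- Subordination: the right side involves √(p² + v), whereas the exponent on the left is linear in
v. The coefficients are chosen so that their product is (s/2)²(p² + v). -/
theorem integral_exp_mul_exp_neg_half_laplace {p s v : ℝ} (hp : 0 < p) (hs : 0 < s) (hv : 0 < v) :
    ∫ u : ℝ, Real.exp (-(p / 2 * s ^ 2 * Real.exp u + (p ^ 2 + v) / (2 * p) * Real.exp (-u))) *
      Real.exp (-u / 2) = √(2 * Real.pi * p) * (Real.exp (-(s * √(p ^ 2 + v))) / √(p ^ 2 + v)) := by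
  rw [integral_exp_neg_mul_exp_add_mul_exp_neg_half (by positivity) (by positivity),
    show p / 2 * s ^ 2 * ((p ^ 2 + v) / (2 * p)) = (s / 2) ^ 2 * (p ^ 2 + v) by field_simp,
    Real.sqrt_mul (by positivity), Real.sqrt_sq (by positivity),
    show Real.pi / ((p ^ 2 + v) / (2 * p)) = (2 * Real.pi * p) / (p ^ 2 + v) by field_simp,
    Real.sqrt_div (by positivity)]
  rw [show 2 * (s / 2 * √(p ^ 2 + v)) = s * √(p ^ 2 + v) by ring]
  ring

theorem integral_besselSeries_mul_exp_neg_sqrt {μ : ℂ} (hμ : -1 < μ.re) {p β s : ℝ} (hp : 0 < p)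
    (hs : 0 < s) :
    ∫ v in Ioi (0 : ℝ), (v : ℂ) ^ μ * besselSeries μ (β ^ 2 / 4 * v : ℝ) *
      ((√(2 * Real.pi * p) * (Real.exp (-(s * √(p ^ 2 + v))) / √(p ^ 2 + v)) : ℝ) : ℂ) =
    ((2 * p : ℝ) : ℂ) ^ (μ + 1) *
      ∫ u : ℝ, (Real.exp (-(p / 2 * (s ^ 2 + β ^ 2) * Real.exp u + p / 2 * Real.exp (-u))) : ℂ) *
        Complex.exp ((μ + 1 / 2) * u) := by
  set Φ : ℝ → ℝ → ℂ := fun v u => (v : ℂ) ^ μ * besselSeries μ (β ^ 2 / 4 * v : ℝ) *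
    ((Real.exp (-(p / 2 * s ^ 2 * Real.exp u + (p ^ 2 + v) / (2 * p) * Real.exp (-u))) *
      Real.exp (-u / 2) : ℝ) : ℂ) with hΦ
  have hcont := continuous_besselSeries hμ
  have hint : ∀ v : ℝ, 0 < v → Integrable fun u : ℝ =>
      Real.exp (-(p / 2 * s ^ 2 * Real.exp u + (p ^ 2 + v) / (2 * p) * Real.exp (-u))) *
      Real.exp (-u / 2) := by
    intro v hv
    have := (integrable_exp_neg_mul_exp_add_mul_exp_neg (a := p / 2 * s ^ 2)
      (b := (p ^ 2 + v) / (2 * p)) (by positivity) (by positivity) (-1 / 2)).re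
    refine this.congr (ae_of_all _ fun u => ?_)
    beta_reduce
    rw [show (-1 / 2 * (u : ℂ)) = ((-u / 2 : ℝ) : ℂ) by push_cast; ring, ← Complex.ofReal_exp,
      ← Complex.ofReal_mul]
    exact Complex.ofReal_re _
  obtain ⟨C, hC, hbd⟩ := exists_norm_besselSeries_le hμ
  have hΦint : Integrable (Function.uncurry Φ) ((volume.restrict (Ioi 0)).prod volume) := by
    rw [integrable_prod_iff]
    · constructor
      · filter_upwards [ae_restrict_mem measurableSet_Ioi] with v hv
        exact ((hint v hv).ofReal (𝕜 := ℂ)).const_mul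
          ((v : ℂ) ^ μ * besselSeries μ (β ^ 2 / 4 * v : ℝ))
      -- The u-integral of the norm is known exactly by subordination, so only the linear growth
      -- bound on the series is needed in v.
      · have := (integrableOn_rpow_mul_exp_neg_sqrt (p := p) hμ hs (β ^ 2 / 4)).const_mul
          (C * √(2 * Real.pi * p) / p)
        refine this.mono' ?_ ?_
        · refine AEStronglyMeasurable.integral_prod_right' (f := fun z => ‖Function.uncurry Φ z‖) ?_
          exact (Measurable.aestronglyMeasurable (by
            simp only [hΦ, Function.uncurry_def]
            fun_prop)).norm
        · filter_upwards [ae_restrict_mem measurableSet_Ioi] with v hv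
          have hv' : 0 < v := hv
          have e : ∫ u : ℝ, ‖Function.uncurry Φ (v, u)‖ =
              v ^ μ.re * ‖besselSeries μ (β ^ 2 / 4 * v : ℝ)‖ *
              (√(2 * Real.pi * p) * (Real.exp (-(s * √(p ^ 2 + v))) / √(p ^ 2 + v))) := by
            rw [← integral_exp_mul_exp_neg_half_laplace hp hs hv', ← integral_const_mul]
            congr 1
            ext u
            simp only [hΦ, Function.uncurry]
            rw [norm_mul, norm_mul, Complex.norm_cpow_eq_rpow_re_of_pos hv', Complex.norm_real,
              Real.norm_of_nonneg (by positivity)]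
          rw [Real.norm_of_nonneg (integral_nonneg fun u => norm_nonneg _), e]
          have h1 := hbd (β ^ 2 / 4 * v) (by positivity)
          have h2 : p ≤ √(p ^ 2 + v) := Real.le_sqrt_of_sq_le (by linarith)
          calc _ ≤ v ^ μ.re * (C * (1 + β ^ 2 / 4 * v)) *
                (√(2 * Real.pi * p) * (Real.exp (-(s * √(p ^ 2 + v))) / p)) := by gcongr
            _ = _ := by ring
    · exact Measurable.aestronglyMeasurable (by
        simp only [hΦ, Function.uncurry_def]
        fun_prop)
  have hswap := integral_integral_swap hΦint
  have hL : ∀ v ∈ Ioi (0 : ℝ), ∫ u : ℝ, Φ v u = (v : ℂ) ^ μ * besselSeries μ (β ^ 2 / 4 * v : ℝ) *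
      ((√(2 * Real.pi * p) * (Real.exp (-(s * √(p ^ 2 + v))) / √(p ^ 2 + v)) : ℝ) : ℂ) := by
    intro v hv
    simp only [hΦ]
    rw [integral_const_mul, integral_complex_ofReal, integral_exp_mul_exp_neg_half_laplace hp hs hv]
  rw [← setIntegral_congr_fun measurableSet_Ioi hL, hswap, ← integral_const_mul]
  congr 1
  ext u
  -- The v-integral is the elementary transform at this rate; it contributes (2p exp u)^(μ+1) and
  -- exp(-pβ² exp(u)/2), and the latter turns s² into s² + β² in the exponent.
  have hr : 0 < Real.exp (-u) / (2 * p) := by positivity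
  have hW := integral_cpow_mul_besselSeries_mul_exp hμ (c := β ^ 2 / 4) (by positivity) hr
  have e0 : ∀ v : ℝ, Φ v u = ((Real.exp (-(p / 2 * s ^ 2 * Real.exp u + p / 2 * Real.exp (-u))) *
      Real.exp (-u / 2) : ℝ) : ℂ) * ((v : ℂ) ^ μ * besselSeries μ (β ^ 2 / 4 * v : ℝ) *
        Complex.exp (-(Real.exp (-u) / (2 * p) * v : ℝ))) := by
    intro v
    have : Real.exp (-(p / 2 * s ^ 2 * Real.exp u + (p ^ 2 + v) / (2 * p) * Real.exp (-u))) =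
        Real.exp (-(p / 2 * s ^ 2 * Real.exp u + p / 2 * Real.exp (-u))) *
          Real.exp (-(Real.exp (-u) / (2 * p) * v)) := by
      rw [← Real.exp_add]
      congr 1
      field_simp
      ring
    simp only [hΦ]
    rw [this]
    push_cast
    ring
  simp only [e0]
  rw [integral_const_mul, hW]
  have e1 : 1 / (Real.exp (-u) / (2 * p)) = 2 * p * Real.exp u := by
    rw [Real.exp_neg]; field_simp
  have e2 : β ^ 2 / 4 / (Real.exp (-u) / (2 * p)) = p / 2 * β ^ 2 * Real.exp u := by
    rw [Real.exp_neg]; field_simp; ring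
  have e3 : ((2 * p * Real.exp u : ℝ) : ℂ) ^ (μ + 1) =
      ((2 * p : ℝ) : ℂ) ^ (μ + 1) * Complex.exp ((μ + 1) * u) := by
    rw [Complex.ofReal_mul, Complex.mul_cpow_ofReal_nonneg (by positivity) (Real.exp_pos u).le]
    congr 1
    rw [Complex.cpow_def_of_ne_zero (by exact_mod_cast (Real.exp_pos u).ne'),
      ← Complex.ofReal_log (Real.exp_pos u).le, Real.log_exp, mul_comm]
  rw [e1, e2, e3]
  have e4 : Complex.exp ((μ + 1 / 2) * u) = Complex.exp ((μ + 1) * u) * Complex.exp (-u / 2) := by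
    rw [← Complex.exp_add]; ring_nf
  have e5 : Real.exp (-(p / 2 * (s ^ 2 + β ^ 2) * Real.exp u + p / 2 * Real.exp (-u))) =
      Real.exp (-(p / 2 * s ^ 2 * Real.exp u + p / 2 * Real.exp (-u))) *
        Real.exp (-(p / 2 * β ^ 2 * Real.exp u)) := by
    rw [← Real.exp_add]; ring_nf
  rw [e4, e5]
  push_cast
  ring

/-- With v = x² - p² the Jacobian 2x cancels the denominator √(p² + v) = x. The rest is bookkeeping
of constants. -/
theorem integral_besselWeight_mul_exp {μ : ℂ} (hμ : -1 < μ.re) {p β s : ℝ} (hp : 0 < p)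
    (hβ : 0 < β) (hs : 0 < s) :
    ∫ x in Ioi p, besselWeight μ p β x * (Real.exp (-(x * s)) : ℂ) =
      ((√(2 / Real.pi) : ℝ) : ℂ) * (p : ℂ) ^ (μ + 1 / 2) * (β : ℂ) ^ μ * (1 / 2) *
      ∫ u : ℝ, (Real.exp (-(p / 2 * (s ^ 2 + β ^ 2) * Real.exp u + p / 2 * Real.exp (-u))) : ℂ) *
        Complex.exp ((μ + 1 / 2) * u) := by
  have h := integral_besselSeries_mul_exp_neg_sqrt hμ (β := β) hp hs
  rw [setIntegral_Ioi_comp_sq_sub_sq hp] at h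
  have e : ∀ x ∈ Ioi p, (2 * x) • (((x ^ 2 - p ^ 2 : ℝ) : ℂ) ^ μ *
      besselSeries μ (β ^ 2 / 4 * (x ^ 2 - p ^ 2) : ℝ) *
      ((√(2 * Real.pi * p) * (Real.exp (-(s * √(p ^ 2 + (x ^ 2 - p ^ 2)))) /
        √(p ^ 2 + (x ^ 2 - p ^ 2))) : ℝ) : ℂ)) =
      2 * (√(2 * Real.pi * p) : ℂ) / ((β / 2 : ℝ) : ℂ) ^ μ *
        (besselWeight μ p β x * (Real.exp (-(x * s)) : ℂ)) := by
    intro x hx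
    have hx0 : 0 < x := hp.trans hx
    have hb : ((β / 2 : ℝ) : ℂ) ^ μ ≠ 0 := by
      rw [Ne, Complex.cpow_eq_zero_iff, not_and_or]
      left
      exact_mod_cast (half_pos hβ).ne'
    rw [besselWeight_eq μ hp hβ hx, add_sub_cancel, Real.sqrt_sq hx0.le, mul_comm s x,
      Complex.real_smul]
    have hxc : (x : ℂ) ≠ 0 := by exact_mod_cast hx0.ne'
    push_cast at hb ⊢
    field_simp
  rw [setIntegral_congr_fun measurableSet_Ioi e, integral_const_mul] at h
  generalize (∫ u : ℝ, (Real.exp (-(p / 2 * (s ^ 2 + β ^ 2) * Real.exp u +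
    p / 2 * Real.exp (-u))) : ℂ) * Complex.exp ((μ + 1 / 2) * u)) = I at *
  have hpi := Real.pi_pos
  have hsq : 0 < √(2 * Real.pi * p) := by positivity
  have hsqc : (√(2 * Real.pi * p) : ℂ) ≠ 0 := by exact_mod_cast hsq.ne'
  have h2 : (2 : ℂ) ^ μ ≠ 0 := by simp [Complex.cpow_eq_zero_iff]
  have hbc : (β : ℂ) ^ μ ≠ 0 := by
    rw [Ne, Complex.cpow_eq_zero_iff, not_and_or]
    left
    exact_mod_cast hβ.ne'
  have e1 : (β : ℂ) ^ μ = (2 : ℂ) ^ μ * ((β / 2 : ℝ) : ℂ) ^ μ := by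
    rw [show (2 : ℂ) = ((2 : ℝ) : ℂ) by norm_num,
      ← Complex.mul_cpow_ofReal_nonneg (by norm_num) (by positivity), ← Complex.ofReal_mul]
    congr 3
    ring
  have hb : ((β / 2 : ℝ) : ℂ) ^ μ ≠ 0 := right_ne_zero_of_mul (e1 ▸ hbc)
  have hpc : (p : ℂ) ≠ 0 := by exact_mod_cast hp.ne'
  have e2 : ((2 * p : ℝ) : ℂ) ^ (μ + 1) = 2 * (2 : ℂ) ^ μ * (p : ℂ) ^ (μ + 1 / 2) * (√p : ℂ) := by
    rw [Complex.ofReal_mul, Complex.mul_cpow_ofReal_nonneg (by norm_num) hp.le,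
      show μ + 1 = (μ + 1 / 2) + ((1 / 2 : ℝ) : ℂ) by push_cast; ring, Complex.cpow_add _ _ hpc,
      ← Complex.ofReal_cpow hp.le, ← Real.sqrt_eq_rpow,
      show μ + 1 / 2 + ((1 / 2 : ℝ) : ℂ) = μ + 1 by push_cast; ring, Complex.ofReal_ofNat,
      Complex.cpow_add _ _ two_ne_zero, Complex.cpow_one]
    ring
  have e3 : (√(2 / Real.pi) : ℂ) * (√(2 * Real.pi * p) : ℂ) = 2 * (√p : ℂ) := by
    rw [← Complex.ofReal_mul, ← Real.sqrt_mul (by positivity),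
      show 2 / Real.pi * (2 * Real.pi * p) = 2 ^ 2 * p by field_simp,
      Real.sqrt_mul (by positivity), Real.sqrt_sq (by norm_num)]
    push_cast
    ring
  rw [e1]
  rw [e2] at h
  generalize (∫ x in Ioi p, besselWeight μ p β x * (Real.exp (-(x * s)) : ℂ)) = K at *
  generalize ((β / 2 : ℝ) : ℂ) ^ μ = b at *
  generalize (p : ℂ) ^ (μ + 1 / 2) = q at *
  field_simp at h
  have : 2 * (√(2 * Real.pi * p) : ℂ) ≠ 0 := mul_ne_zero two_ne_zero hsqc
  apply mul_left_cancel₀ this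
  linear_combination 2 * h - 2 ^ μ * b * q * I * e3

/-- The factor of `G t` in `tIntegrand`, as an integral over the whole line. -/
theorem half_mul_integral_eq_besselK (μ : ℂ) {p β : ℝ} (s : ℝ) (hp : 0 < p) (hβ : 0 < β) :
    (1 / 2 : ℂ) * ∫ u : ℝ, (Real.exp (-(p / 2 * (s ^ 2 + β ^ 2) * Real.exp u +
        p / 2 * Real.exp (-u))) : ℂ) * Complex.exp ((μ + 1 / 2) * u) =
      ((s ^ 2 + β ^ 2 : ℝ) : ℂ) ^ (-μ / 2 - 1 / 4) *
        besselK (μ + 1 / 2) (p * √(s ^ 2 + β ^ 2)) := by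
  have ha : 0 < s ^ 2 + β ^ 2 := by positivity
  rw [integral_exp_neg_mul_exp_add_mul_exp_neg (by positivity) (by positivity),
    show p / 2 / (p / 2 * (s ^ 2 + β ^ 2)) = (s ^ 2 + β ^ 2)⁻¹ by field_simp,
    show p / 2 * (s ^ 2 + β ^ 2) * (p / 2) = (p / 2) ^ 2 * (s ^ 2 + β ^ 2) by ring,
    Real.sqrt_mul (by positivity), Real.sqrt_sq (by positivity),
    show 2 * (p / 2 * √(s ^ 2 + β ^ 2)) = p * √(s ^ 2 + β ^ 2) by ring,
    show -μ / 2 - 1 / 4 = -((μ + 1 / 2) / 2) by ring, Complex.cpow_neg, Complex.ofReal_inv,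
    Complex.inv_cpow _ _ (by rw [Complex.arg_ofReal_of_nonneg ha.le]; exact Real.pi_pos.ne)]
  ring

/-! ### Size and asymptotics of the Laplace transform of the weight -/

theorem integrableOn_Ioi_comp_add_left_iff (f : ℝ → ℂ) (p : ℝ) :
    IntegrableOn (fun u => f (p + u)) (Ioi 0) ↔ IntegrableOn f (Ioi p) := by
  have := (measurePreserving_add_left volume p).integrableOn_comp_preimage
    (measurableEmbedding_addLeft p) (f := f) (s := Ioi p)
  simpa [Function.comp_def] using this

theorem integral_Ioi_comp_add_left {E : Type*} [NormedAddCommGroup E] [NormedSpace ℝ E]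
    (f : ℝ → E) (p : ℝ) :
    ∫ u in Ioi (0 : ℝ), f (p + u) = ∫ x in Ioi p, f x := by
  have := (measurePreserving_add_left volume p).setIntegral_preimage_emb
    (measurableEmbedding_addLeft p) f (Ioi p)
  simpa using this

/-- `besselWeight μ p β (p + u)` without its factor `u ^ μ`. -/
noncomputable def besselWeightRegular (μ : ℂ) (p β u : ℝ) : ℂ :=
  ((2 * p + u : ℝ) : ℂ) ^ μ * ((β / 2 : ℝ) : ℂ) ^ μ *
    besselSeries μ (β ^ 2 / 4 * (u * (2 * p + u)) : ℝ)

theorem besselWeight_add (μ : ℂ) {p β u : ℝ} (hp : 0 < p) (hβ : 0 < β) (hu : 0 < u) :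
    besselWeight μ p β (p + u) = (u : ℂ) ^ μ * besselWeightRegular μ p β u := by
  rw [besselWeight_eq μ hp hβ (by linarith), besselWeightRegular,
    show (p + u) ^ 2 - p ^ 2 = u * (2 * p + u) by ring, Complex.ofReal_mul u,
    Complex.mul_cpow_ofReal_nonneg hu.le (by positivity)]
  ring

theorem measurable_besselWeight {μ : ℂ} (hμ : -1 < μ.re) (p β : ℝ) :
    Measurable (besselWeight μ p β) := by
  have := continuous_besselSeries hμ
  unfold besselWeight
  simp only [besselJ_eq_besselSeries]
  fun_prop

theorem measurable_besselWeightRegular {μ : ℂ} (hμ : -1 < μ.re) (p β : ℝ) :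
    Measurable (besselWeightRegular μ p β) := by
  have := continuous_besselSeries hμ
  unfold besselWeightRegular
  fun_prop

theorem continuousAt_besselWeightRegular {μ : ℂ} (hμ : -1 < μ.re) {p : ℝ} (hp : 0 < p) (β : ℝ) :
    ContinuousAt (besselWeightRegular μ p β) 0 := by
  have h := continuous_besselSeries hμ
  have h1 : ContinuousAt (fun u : ℝ => ((2 * p + u : ℝ) : ℂ) ^ μ) 0 := by
    refine ContinuousAt.cpow (by fun_prop) continuousAt_const ?_
    rw [Complex.ofReal_mem_slitPlane]
    linarith
  refine (h1.mul continuousAt_const).mul ?_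
  fun_prop

theorem besselWeightRegular_zero (μ : ℂ) {p β : ℝ} (hp : 0 < p) (hβ : 0 < β) :
    besselWeightRegular μ p β 0 = ((p * β : ℝ) : ℂ) ^ μ * (Complex.Gamma (μ + 1))⁻¹ := by
  rw [besselWeightRegular, add_zero, zero_mul, mul_zero, Complex.ofReal_zero, besselSeries_zero,
    ← Complex.mul_cpow_ofReal_nonneg (by positivity) (by positivity), ← Complex.ofReal_mul]
  rw [show 2 * p * (β / 2) = p * β by ring]

theorem rpow_le_mul_exp {a δ y : ℝ} (ha : 0 < a) (hδ : 0 < δ) (hy : 0 < y) :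
    y ^ a ≤ (a / δ) ^ a * Real.exp (δ * y) := by
  have h1 : y ≤ (a / δ) * Real.exp (δ * y / a) := by
    have := Real.add_one_le_exp (δ * y / a)
    calc y = (a / δ) * (δ * y / a) := by field_simp
      _ ≤ _ := by gcongr; linarith
  calc y ^ a ≤ ((a / δ) * Real.exp (δ * y / a)) ^ a := Real.rpow_le_rpow hy.le h1 ha.le
    _ = _ := by
      rw [Real.mul_rpow (by positivity) (Real.exp_pos _).le, ← Real.exp_mul]
      congr 2
      field_simp

theorem exists_norm_besselWeightRegular_le {μ : ℂ} (hμ : -1 < μ.re) {p β δ : ℝ} (hp : 0 < p)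
    (hβ : 0 < β) (hδ : 0 < δ) :
    ∃ C : ℝ, 0 < C ∧ ∀ u : ℝ, 0 < u → ‖besselWeightRegular μ p β u‖ ≤ C * Real.exp (δ * u) := by
  obtain ⟨C, hC, h⟩ := exists_norm_besselSeries_le hμ
  have ha : 0 < μ.re + 2 := by linarith
  refine ⟨(β / 2) ^ μ.re * C * (1 / (4 * p ^ 2) + β ^ 2 / 4) *
    (((μ.re + 2) / δ) ^ (μ.re + 2) * Real.exp (δ * (2 * p))), by positivity, fun u hu => ?_⟩
  have hy : 0 < 2 * p + u := by positivity
  have h1 := rpow_le_mul_exp ha hδ hy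
  have h2 := h (β ^ 2 / 4 * (u * (2 * p + u))) (by positivity)
  -- As 2p + u ≥ 2p, the constant 1 is absorbed too; the total exponent becomes Re μ + 2, positive
  -- even when Re μ < 0.
  have h3 : 1 + β ^ 2 / 4 * (u * (2 * p + u)) ≤
      (1 / (4 * p ^ 2) + β ^ 2 / 4) * (2 * p + u) ^ 2 := by
    have e1 : 1 ≤ 1 / (4 * p ^ 2) * (2 * p + u) ^ 2 := by
      rw [div_mul_eq_mul_div, one_mul, le_div_iff₀ (by positivity)]
      nlinarith
    have e2 : u * (2 * p + u) ≤ (2 * p + u) ^ 2 := by nlinarith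
    have e3 := mul_le_mul_of_nonneg_left e2 (by positivity : 0 ≤ β ^ 2 / 4)
    linarith
  rw [besselWeightRegular, norm_mul, norm_mul, Complex.norm_cpow_eq_rpow_re_of_pos hy,
    Complex.norm_cpow_eq_rpow_re_of_pos (half_pos hβ)]
  calc _ ≤ (2 * p + u) ^ μ.re * (β / 2) ^ μ.re *
        (C * ((1 / (4 * p ^ 2) + β ^ 2 / 4) * (2 * p + u) ^ 2)) := by
        gcongr
        exact h2.trans (by gcongr)
    _ = (β / 2) ^ μ.re * C * (1 / (4 * p ^ 2) + β ^ 2 / 4) * (2 * p + u) ^ (μ.re + 2) := by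
        rw [Real.rpow_add hy, Real.rpow_two]
        ring
    _ ≤ (β / 2) ^ μ.re * C * (1 / (4 * p ^ 2) + β ^ 2 / 4) *
        (((μ.re + 2) / δ) ^ (μ.re + 2) * Real.exp (δ * (2 * p + u))) := by gcongr
    _ = _ := by
        rw [mul_add δ, Real.exp_add]
        ring

/-- Only an arbitrarily small rate δ is lost to the growth of the regular factor, so the bound keeps
the true order as t → ∞. -/
theorem exists_laplace_besselWeight_bound {μ : ℂ} (hμ : -1 < μ.re) {p β δ : ℝ} (hp : 0 < p)
    (hβ : 0 < β) (hδ : 0 < δ) :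
    ∃ C : ℝ, 0 < C ∧ ∀ t : ℝ, δ < t →
      IntegrableOn (fun x => besselWeight μ p β x * (Real.exp (-(x * t)) : ℂ)) (Ioi p) ∧
      ∫ x in Ioi p, ‖besselWeight μ p β x * (Real.exp (-(x * t)) : ℂ)‖ ≤
        C * Real.exp (-(p * t)) * (1 / (t - δ)) ^ (μ.re + 1) := by
  obtain ⟨C, hC, h⟩ := exists_norm_besselWeightRegular_le hμ hp hβ hδ
  have hσ : 0 < μ.re + 1 := by linarith
  refine ⟨C * Real.Gamma (μ.re + 1), mul_pos hC (Real.Gamma_pos_of_pos hσ), fun t ht => ?_⟩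
  have htδ : 0 < t - δ := by linarith
  have hbd : ∀ u ∈ Ioi (0 : ℝ), ‖besselWeight μ p β (p + u) * (Real.exp (-((p + u) * t)) : ℂ)‖ ≤
      C * Real.exp (-(p * t)) * (u ^ (μ.re + 1 - 1) * Real.exp (-((t - δ) * u))) := by
    intro u hu
    have hu' : 0 < u := hu
    rw [besselWeight_add μ hp hβ hu, norm_mul, norm_mul, Complex.norm_cpow_eq_rpow_re_of_pos hu,
      Complex.norm_real, Real.norm_of_nonneg (Real.exp_pos _).le, add_sub_cancel_right]
    calc _ ≤ u ^ μ.re * (C * Real.exp (δ * u)) * Real.exp (-((p + u) * t)) := by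
          gcongr
          exact h u hu
      _ = C * u ^ μ.re * (Real.exp (δ * u) * Real.exp (-((p + u) * t))) := by ring
      _ = C * u ^ μ.re * (Real.exp (-(p * t)) * Real.exp (-((t - δ) * u))) := by
          rw [← Real.exp_add, ← Real.exp_add]; ring_nf
      _ = _ := by ring
  have hi : IntegrableOn (fun u : ℝ => C * Real.exp (-(p * t)) *
      (u ^ (μ.re + 1 - 1) * Real.exp (-((t - δ) * u)))) (Ioi 0) := by
    have := integrableOn_rpow_mul_exp_neg_mul_rpow (p := 1) (s := μ.re + 1 - 1) (b := t - δ)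
      (by linarith) one_pos htδ
    simp only [Real.rpow_one] at this
    refine IntegrableOn.congr_fun (this.const_mul (C * Real.exp (-(p * t)))) (fun u _ => ?_)
      measurableSet_Ioi
    simp only [neg_mul]
  have hm := measurable_besselWeight hμ p β
  constructor
  · rw [← integrableOn_Ioi_comp_add_left_iff]
    refine hi.mono' (Measurable.aestronglyMeasurable (by fun_prop)) ?_
    filter_upwards [ae_restrict_mem measurableSet_Ioi] with u hu using hbd u hu
  · rw [← integral_Ioi_comp_add_left]
    refine (integral_mono_of_nonneg (ae_of_all _ fun u => norm_nonneg _) hi ?_).trans_eq ?_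
    · filter_upwards [ae_restrict_mem measurableSet_Ioi] with u hu using hbd u hu
    · rw [integral_const_mul, Real.integral_rpow_mul_exp_neg_mul_Ioi hσ htδ]
      ring

theorem integrableOn_besselWeight_mul_exp {μ : ℂ} (hμ : -1 < μ.re) {p β t : ℝ} (hp : 0 < p)
    (hβ : 0 < β) (ht : 0 < t) :
    IntegrableOn (fun x => besselWeight μ p β x * (Real.exp (-(x * t)) : ℂ)) (Ioi p) := by
  obtain ⟨C, -, h⟩ := exists_laplace_besselWeight_bound hμ hp hβ (half_pos ht)
  exact (h t (half_lt_self ht)).1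

/-- Watson's lemma for the Laplace transform of `besselWeight`. -/
theorem tendsto_laplace_besselWeight {μ : ℂ} (hμ : -1 < μ.re) {p β : ℝ} (hp : 0 < p)
    (hβ : 0 < β) :
    Tendsto (fun s : ℝ => (s : ℂ) ^ (μ + 1) * (Real.exp (p * s) : ℂ) *
      ∫ x in Ioi p, besselWeight μ p β x * (Real.exp (-(x * s)) : ℂ)) atTop
      (𝓝 (((p * β : ℝ) : ℂ) ^ μ)) := by
  have hσ : 0 < (μ + 1).re := by simp; linarith
  obtain ⟨C, hC, h⟩ := exists_norm_besselWeightRegular_le hμ hp hβ (δ := 1 / 2) (by norm_num)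
  have hlim : ((p * β : ℝ) : ℂ) ^ μ = ∫ v in Ioi (0 : ℝ),
      (v : ℂ) ^ μ * (Real.exp (-v) : ℂ) * besselWeightRegular μ p β 0 := by
    have hG : Complex.Gamma (μ + 1) ≠ 0 := Complex.Gamma_ne_zero_of_re_pos hσ
    have e := Complex.integral_cpow_mul_exp_neg_mul_Ioi hσ one_pos
    simp only [add_sub_cancel_right, Complex.ofReal_one, one_mul, div_one, Complex.one_cpow] at e
    rw [integral_mul_const, besselWeightRegular_zero μ hp hβ]
    push_cast
    rw [e]
    field_simp
  rw [hlim]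
  -- Rescaling u = v/s freezes the singular factor and the exponential; only the regular factor
  -- still depends on s, through its argument v/s → 0.
  have key : ∀ᶠ s : ℝ in atTop, ∫ v in Ioi (0 : ℝ),
      (v : ℂ) ^ μ * (Real.exp (-v) : ℂ) * besselWeightRegular μ p β (s⁻¹ * v) =
      (s : ℂ) ^ (μ + 1) * (Real.exp (p * s) : ℂ) *
      ∫ x in Ioi p, besselWeight μ p β x * (Real.exp (-(x * s)) : ℂ) := by
    filter_upwards [eventually_gt_atTop 0] with s hs
    have hs' : (s : ℂ) ≠ 0 := by exact_mod_cast hs.ne'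
    rw [← integral_Ioi_comp_add_left _ p]
    have := integral_comp_mul_left_Ioi (fun u => besselWeight μ p β (p + u) *
      (Real.exp (-((p + u) * s)) : ℂ)) 0 (inv_pos.2 hs)
    rw [mul_zero, inv_inv, Complex.real_smul, eq_comm, ← eq_inv_mul_iff_mul_eq₀ hs'] at this
    rw [this, ← mul_assoc, ← integral_const_mul]
    refine setIntegral_congr_fun measurableSet_Ioi fun v hv => ?_
    have hv' : 0 < v := hv
    have e1 : ((s⁻¹ * v : ℝ) : ℂ) ^ μ * (s : ℂ) ^ μ = (v : ℂ) ^ μ := by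
      rw [← Complex.mul_cpow_ofReal_nonneg (by positivity) hs.le, ← Complex.ofReal_mul]
      congr 2
      field_simp
    have e2 : (Real.exp (-v) : ℂ) = (Real.exp (p * s) : ℂ) *
        (Real.exp (-((p + s⁻¹ * v) * s)) : ℂ) := by
      rw [← Complex.ofReal_mul, ← Real.exp_add]
      congr 2
      field_simp
      ring
    rw [besselWeight_add μ hp hβ (by positivity), Complex.cpow_add _ _ hs', Complex.cpow_one,
      ← e1, e2]
    field_simp
  refine Tendsto.congr' key ?_
  have hm := measurable_besselWeightRegular hμ p β
  refine tendsto_integral_filter_of_dominated_convergence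
    (fun v : ℝ => C * (v ^ μ.re * Real.exp (-(1 / 2) * v ^ (1 : ℝ)))) ?_ ?_ ?_ ?_
  · exact Eventually.of_forall fun s => Measurable.aestronglyMeasurable (by fun_prop)
  · filter_upwards [eventually_ge_atTop 1] with s hs
    filter_upwards [ae_restrict_mem measurableSet_Ioi] with v hv
    have hv' : 0 < v := hv
    have hs0 : 0 < s := by linarith
    rw [norm_mul, norm_mul, Complex.norm_cpow_eq_rpow_re_of_pos hv, Complex.norm_real,
      Real.norm_of_nonneg (Real.exp_pos _).le, Real.rpow_one]
    have h1 := h (s⁻¹ * v) (by positivity)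
    have h2 : s⁻¹ * v ≤ v := mul_le_of_le_one_left hv'.le (inv_le_one_of_one_le₀ hs)
    calc _ ≤ v ^ μ.re * Real.exp (-v) * (C * Real.exp (1 / 2 * v)) := by
          gcongr
          exact h1.trans (by gcongr)
      _ = C * (v ^ μ.re * (Real.exp (-v) * Real.exp (1 / 2 * v))) := by ring
      _ = _ := by rw [← Real.exp_add]; ring_nf
  · exact (integrableOn_rpow_mul_exp_neg_mul_rpow hμ one_pos (by norm_num)).const_mul C
  · refine ae_of_all _ fun v => Tendsto.const_mul _ ?_
    have h0 : Tendsto (fun s : ℝ => s⁻¹ * v) atTop (𝓝 0) := by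
      simpa using tendsto_inv_atTop_zero.mul_const v
    exact (continuousAt_besselWeightRegular hμ hp β).tendsto.comp h0

/-- Near x = p, which dominates for large t, W behaves like a nonzero constant times (x - p)^μ, so
cancellation costs at most a constant factor. -/
theorem exists_laplace_norm_besselWeight_le {μ : ℂ} (hμ : -1 < μ.re) {p β : ℝ} (hp : 0 < p)
    (hβ : 0 < β) :
    ∃ C T : ℝ, 0 < C ∧ 0 < T ∧ ∀ t : ℝ, T ≤ t →
      ∫ x in Ioi p, ‖besselWeight μ p β x * (Real.exp (-(x * t)) : ℂ)‖ ≤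
        C * ‖∫ x in Ioi p, besselWeight μ p β x * (Real.exp (-(x * t)) : ℂ)‖ := by
  obtain ⟨C, hC, h⟩ := exists_laplace_besselWeight_bound hμ hp hβ (δ := 1 / 2) (by norm_num)
  have hpβ : 0 < p * β := mul_pos hp hβ
  have hlim := (tendsto_laplace_besselWeight hμ hp hβ).norm
  rw [Complex.norm_cpow_eq_rpow_re_of_pos hpβ] at hlim
  set c := (p * β) ^ μ.re with hc
  have hc0 : 0 < c := Real.rpow_pos_of_pos hpβ _
  obtain ⟨T, hT⟩ := eventually_atTop.1 (hlim.eventually (lt_mem_nhds (half_lt_self hc0)))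
  have hσ : 0 < μ.re + 1 := by linarith
  -- Half the Watson limit c bounds the scaled transform from below beyond T, and t ≥ 1 gives t -
  -- 1/2 ≥ t/2, whence the power of 2.
  refine ⟨C * 2 ^ (μ.re + 1) / (c / 2), max T 1, by positivity, by positivity, fun t ht => ?_⟩
  have ht1 : 1 ≤ t := (le_max_right _ _).trans ht
  have ht0 : 0 < t := by linarith
  have h1 := (h t (by linarith)).2
  have h2 := hT t ((le_max_left _ _).trans ht)
  rw [norm_mul, norm_mul, Complex.norm_cpow_eq_rpow_re_of_pos ht0, Complex.norm_real,
    Real.norm_of_nonneg (Real.exp_pos _).le, Complex.add_re, Complex.one_re] at h2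
  set N := ‖∫ x in Ioi p, besselWeight μ p β x * (Real.exp (-(x * t)) : ℂ)‖
  have h3 : (1 / (t - 1 / 2)) ^ (μ.re + 1) ≤ 2 ^ (μ.re + 1) / t ^ (μ.re + 1) := by
    rw [← Real.div_rpow (by norm_num) ht0.le]
    apply Real.rpow_le_rpow (by apply one_div_nonneg.2; linarith) _ hσ.le
    rw [div_le_div_iff₀ (by linarith) ht0]
    linarith
  have ht' : 0 < t ^ (μ.re + 1) := Real.rpow_pos_of_pos ht0 _
  refine h1.trans ?_
  calc _ ≤ C * Real.exp (-(p * t)) * (2 ^ (μ.re + 1) / t ^ (μ.re + 1)) := by gcongr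
    _ = C * 2 ^ (μ.re + 1) / (c / 2) * ((c / 2) / (t ^ (μ.re + 1) * Real.exp (p * t))) := by
      rw [Real.exp_neg]
      field_simp
    _ ≤ _ := by
      gcongr
      rw [div_le_iff₀ (by positivity)]
      linarith

/-! ### The substitution x = √(y² + p²) -/

theorem image_sqrt_sq_add_sq_Ioc {p b : ℝ} (hp : 0 < p) (hb : 0 < b) :
    (fun y : ℝ => √(y ^ 2 + p ^ 2)) '' Ioc 0 b = Ioc p (√(b ^ 2 + p ^ 2)) := by
  ext x
  constructor
  · rintro ⟨y, ⟨hy, hyb⟩, rfl⟩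
    exact ⟨Real.lt_sqrt_of_sq_lt (by nlinarith), Real.sqrt_le_sqrt (by gcongr)⟩
  · rintro ⟨hx, hxb⟩
    have hw := sq_sub_sq_pos hp hx
    have hx0 : 0 < x := hp.trans hx
    refine ⟨√(x ^ 2 - p ^ 2), ⟨Real.sqrt_pos.2 hw, ?_⟩, ?_⟩
    · rw [Real.le_sqrt hx0.le (by positivity)] at hxb
      exact Real.sqrt_le_iff.2 ⟨hb.le, by linarith⟩
    · simp only
      rw [Real.sq_sqrt hw.le, sub_add_cancel, Real.sqrt_sq hx0.le]

theorem injOn_sqrt_sq_add_sq (p b : ℝ) :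
    InjOn (fun y : ℝ => √(y ^ 2 + p ^ 2)) (Ioc 0 b) := fun y hy z hz h => by
  have h' := (Real.sqrt_inj (by positivity) (by positivity)).1 h
  exact (sq_eq_sq₀ hy.1.le hz.1.le).1 (by linarith)

theorem hasDerivAt_sqrt_sq_add_sq {p : ℝ} (hp : 0 < p) (y : ℝ) :
    HasDerivAt (fun y : ℝ => √(y ^ 2 + p ^ 2)) (y / √(y ^ 2 + p ^ 2)) y := by
  convert ((hasDerivAt_pow 2 y).add_const (p ^ 2)).sqrt (by positivity) using 1
  field_simp
  simp [mul_comm]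

theorem deriv_smul_xIntegrand_comp (μ : ℂ) {p : ℝ} (β : ℝ) (F : ℝ → ℂ) (hp : 0 < p) {y : ℝ}
    (hy : 0 < y) :
    |y / √(y ^ 2 + p ^ 2)| • xIntegrand μ p β F (√(y ^ 2 + p ^ 2)) = yIntegrand μ p β F y := by
  have h : √(y ^ 2 + p ^ 2) ^ 2 - p ^ 2 = y ^ 2 := by
    rw [Real.sq_sqrt (by positivity)]; ring
  rw [abs_of_pos (by positivity), xIntegrand, yIntegrand, h, Real.sqrt_sq hy.le,
    ofReal_sq_cpow_half hy, Complex.real_smul, Complex.ofReal_div,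
    Complex.cpow_add _ _ (by exact_mod_cast hy.ne'), Complex.cpow_one]
  ring

theorem integrableOn_xIntegrand_iff (μ : ℂ) {p : ℝ} (β : ℝ) (F : ℝ → ℂ) (hp : 0 < p) {b : ℝ}
    (hb : 0 < b) :
    IntegrableOn (xIntegrand μ p β F) (Ioc p (√(b ^ 2 + p ^ 2))) ↔
      IntegrableOn (yIntegrand μ p β F) (Ioc 0 b) := by
  rw [← image_sqrt_sq_add_sq_Ioc hp hb,
    integrableOn_image_iff_integrableOn_abs_deriv_smul measurableSet_Ioc
      (fun y _ => (hasDerivAt_sqrt_sq_add_sq hp y).hasDerivWithinAt) (injOn_sqrt_sq_add_sq p b)]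
  exact integrableOn_congr_fun (fun y hy => deriv_smul_xIntegrand_comp μ β F hp hy.1)
    measurableSet_Ioc

theorem intervalIntegral_xIntegrand_eq (μ : ℂ) {p : ℝ} (β : ℝ) (F : ℝ → ℂ) (hp : 0 < p) {b : ℝ}
    (hb : 0 < b) :
    ∫ x in p..√(b ^ 2 + p ^ 2), xIntegrand μ p β F x = ∫ y in 0..b, yIntegrand μ p β F y := by
  rw [intervalIntegral.integral_of_le (Real.le_sqrt_of_sq_le (by nlinarith)),
    intervalIntegral.integral_of_le hb.le, ← image_sqrt_sq_add_sq_Ioc hp hb,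
    integral_image_eq_integral_abs_deriv_smul measurableSet_Ioc
      (fun y _ => (hasDerivAt_sqrt_sq_add_sq hp y).hasDerivWithinAt) (injOn_sqrt_sq_add_sq p b)]
  exact setIntegral_congr_fun measurableSet_Ioc
    (fun y hy => deriv_smul_xIntegrand_comp μ β F hp hy.1)

theorem hasImproperIntegral_xIntegrand_iff (μ : ℂ) {p : ℝ} (β : ℝ) (F : ℝ → ℂ) (hp : 0 < p)
    (I : ℂ) :
    HasImproperIntegral (xIntegrand μ p β F) p I ↔
      HasImproperIntegral (yIntegrand μ p β F) 0 I := by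
  have hinv : ∀ b, p < b → 0 < √(b ^ 2 - p ^ 2) ∧ √(√(b ^ 2 - p ^ 2) ^ 2 + p ^ 2) = b := by
    intro b hb
    have hw := sq_sub_sq_pos hp hb
    exact ⟨Real.sqrt_pos.2 hw, by
      rw [Real.sq_sqrt hw.le, sub_add_cancel, Real.sqrt_sq (hp.trans hb).le]⟩
  constructor
  · rintro ⟨h1, h2⟩
    refine ⟨fun b hb => (integrableOn_xIntegrand_iff μ β F hp hb).1
      (h1 _ (Real.lt_sqrt_of_sq_lt (by nlinarith))), ?_⟩
    have ht : Tendsto (fun b : ℝ => √(b ^ 2 + p ^ 2)) atTop atTop :=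
      tendsto_atTop_mono (fun b => Real.le_sqrt_of_sq_le (by simp only [id]; nlinarith)) tendsto_id
    refine (h2.comp ht).congr' ?_
    filter_upwards [eventually_gt_atTop 0] with b hb
    exact intervalIntegral_xIntegrand_eq μ β F hp hb
  · rintro ⟨h1, h2⟩
    refine ⟨fun b hb => ?_, ?_⟩
    · obtain ⟨e1, e2⟩ := hinv b hb
      have := (integrableOn_xIntegrand_iff μ β F hp e1).2 (h1 _ e1)
      rwa [e2] at this
    · have ht : Tendsto (fun b : ℝ => √(b ^ 2 - p ^ 2)) atTop atTop := by
        refine tendsto_atTop_mono' _ ?_ (tendsto_atTop_add_const_right atTop (-p) tendsto_id)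
        filter_upwards [eventually_ge_atTop p] with b hb
        simp only [id]
        exact Real.le_sqrt_of_sq_le (by nlinarith)
      refine (h2.comp ht).congr' ?_
      filter_upwards [eventually_gt_atTop p] with b hb
      obtain ⟨e1, e2⟩ := hinv b hb
      have := intervalIntegral_xIntegrand_eq μ β F hp e1
      rw [e2] at this
      exact this.symm

/-! ### Abel summation of improper integrals -/

namespace HasImproperIntegral

variable {f : ℝ → ℂ} {a : ℝ} {I : ℂ}

theorem continuousOn_primitive (h : HasImproperIntegral f a I) :
    ContinuousOn (fun s => ∫ x in a..s, f x) (Ici a) := by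
  intro s hs
  have hs' : a ≤ s := hs
  have hle : a ≤ s + 1 := by linarith
  have h1 : IntegrableOn f (uIcc a (s + 1)) := by
    rw [uIcc_of_le hle, integrableOn_Icc_iff_integrableOn_Ioc]
    exact h.1 _ (by linarith)
  have h2 := intervalIntegral.continuousOn_primitive_interval h1
  rw [uIcc_of_le hle] at h2
  refine (h2 s ⟨hs', by linarith⟩).mono_of_mem_nhdsWithin ?_
  rw [← Ici_inter_Iic]
  exact inter_mem self_mem_nhdsWithin (mem_nhdsWithin_of_mem_nhds (Iic_mem_nhds (by linarith)))

theorem exists_norm_primitive_le (h : HasImproperIntegral f a I) :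
    ∃ M : ℝ, ∀ s, a ≤ s → ‖∫ x in a..s, f x‖ ≤ M := by
  obtain ⟨S, hS⟩ := eventually_atTop.1
    (h.2.norm.eventually (ge_mem_nhds (lt_add_one ‖I‖)))
  obtain ⟨M, hM⟩ := (isCompact_Icc (a := a) (b := S)).exists_bound_of_continuousOn
    (h.continuousOn_primitive.mono Icc_subset_Ici_self)
  refine ⟨max M (‖I‖ + 1), fun s hs => ?_⟩
  rcases le_total s S with h1 | h1
  · exact (hM s ⟨hs, h1⟩).trans (le_max_left _ _)
  · exact (hS s h1).trans (le_max_right _ _)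

/-- Integration by parts done by Fubini: exp(-xε) is the integral of ε exp(-sε) over s > x, and the
order is exchanged on the region x ≤ s. No continuity of f is needed. -/
theorem integral_mul_exp_eq {ε : ℝ} (hε : 0 < ε)
    (hint : IntegrableOn (fun x => f x * (Real.exp (-(x * ε)) : ℂ)) (Ioi a)) :
    ∫ x in Ioi a, f x * (Real.exp (-(x * ε)) : ℂ) =
      ∫ s in Ioi a, ((ε * Real.exp (-(s * ε)) : ℝ) : ℂ) * ∫ x in a..s, f x := by
  set K : ℝ → ℝ → ℂ := fun x s =>
    {z : ℝ × ℝ | z.1 ≤ z.2}.indicator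
      (fun z => f z.1 * ((ε * Real.exp (-(z.2 * ε)) : ℝ) : ℂ)) (x, s) with hK
  have hf : AEStronglyMeasurable f (volume.restrict (Ioi a)) := by
    have h1 : AEStronglyMeasurable (fun x : ℝ => (Real.exp (x * ε) : ℂ))
      (volume.restrict (Ioi a)) := Measurable.aestronglyMeasurable (by fun_prop)
    refine (hint.aestronglyMeasurable.mul h1).congr (ae_of_all _ fun x => ?_)
    simp only [Pi.mul_apply]
    rw [mul_assoc, ← Complex.ofReal_mul, ← Real.exp_add]
    simp
  have hKm : AEStronglyMeasurable (Function.uncurry K)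
      ((volume.restrict (Ioi a)).prod (volume.restrict (Ioi a))) := by
    have h2 : AEStronglyMeasurable (fun s : ℝ => ((ε * Real.exp (-(s * ε)) : ℝ) : ℂ))
      (volume.restrict (Ioi a)) := Measurable.aestronglyMeasurable (by fun_prop)
    exact (hf.comp_fst.mul h2.comp_snd).indicator (measurableSet_le measurable_fst measurable_snd)
  have hexp : ∀ x : ℝ, IntegrableOn (fun s : ℝ => ε * Real.exp (-(s * ε))) (Ioi x) ∧
      ∫ s in Ioi x, ε * Real.exp (-(s * ε)) = Real.exp (-(x * ε)) := by
    intro x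
    have e : ∀ s : ℝ, -(s * ε) = -ε * s := fun s => by ring
    simp only [e]
    refine ⟨(integrableOn_exp_mul_Ioi (neg_lt_zero.2 hε) x).const_mul ε, ?_⟩
    rw [integral_const_mul, integral_exp_mul_Ioi (neg_lt_zero.2 hε)]
    field_simp
  have hKx : ∀ x : ℝ, K x = (Ici x).indicator
      (fun s => f x * ((ε * Real.exp (-(s * ε)) : ℝ) : ℂ)) := fun x => by
    ext s
    by_cases hs : x ≤ s <;> simp [hK, hs]
  have hKs : ∀ s : ℝ, (fun x => K x s) = (Iic s).indicator
      (fun x => f x * ((ε * Real.exp (-(s * ε)) : ℝ) : ℂ)) := fun s => by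
    ext x
    by_cases hs : x ≤ s <;> simp [hK, hs]
  have hset : ∀ x, a < x → (volume.restrict (Ioi a)).restrict (Ici x) = volume.restrict (Ioi x) :=
    fun x hx => by
      rw [Measure.restrict_restrict measurableSet_Ici,
        inter_eq_left.2 (Ici_subset_Ioi.2 hx)]
      exact (restrict_Ioi_eq_restrict_Ici).symm
  have hKint : Integrable (Function.uncurry K)
      ((volume.restrict (Ioi a)).prod (volume.restrict (Ioi a))) := by
    rw [integrable_prod_iff hKm]
    constructor
    · filter_upwards [ae_restrict_mem measurableSet_Ioi] with x hx
      change Integrable (K x) _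
      rw [hKx x, integrable_indicator_iff measurableSet_Ici, IntegrableOn, hset x hx]
      exact ((hexp x).1.ofReal (𝕜 := ℂ)).const_mul (f x)
    · refine hint.norm.congr ?_
      filter_upwards [ae_restrict_mem measurableSet_Ioi] with x hx
      change _ = ∫ s in Ioi a, ‖K x s‖
      simp only [hKx x, norm_indicator_eq_indicator_norm]
      rw [integral_indicator measurableSet_Ici, hset x hx, norm_mul, Complex.norm_real,
        Real.norm_of_nonneg (Real.exp_pos _).le, ← (hexp x).2, ← integral_const_mul]
      congr 1
      ext s
      rw [norm_mul, Complex.norm_real, Real.norm_of_nonneg (by positivity)]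
  have hswap := integral_integral_swap hKint
  have e1 : ∀ x ∈ Ioi a, ∫ s in Ioi a, K x s = f x * (Real.exp (-(x * ε)) : ℂ) := by
    intro x hx
    rw [hKx x, integral_indicator measurableSet_Ici, hset x hx, integral_const_mul,
      integral_complex_ofReal, (hexp x).2]
  have e2 : ∀ s ∈ Ioi a, ∫ x in Ioi a, K x s =
      ((ε * Real.exp (-(s * ε)) : ℝ) : ℂ) * ∫ x in a..s, f x := by
    intro s hs
    rw [hKs s, integral_indicator measurableSet_Iic, Measure.restrict_restrict measurableSet_Iic,
      inter_comm, Ioi_inter_Iic, integral_mul_const, mul_comm,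
      intervalIntegral.integral_of_le (le_of_lt hs)]
  rw [← setIntegral_congr_fun measurableSet_Ioi e1, hswap,
    setIntegral_congr_fun measurableSet_Ioi e2]

/-- Abel's theorem for improper integrals. -/
theorem tendsto_integral_mul_exp (h : HasImproperIntegral f a I)
    (hint : ∀ ε : ℝ, 0 < ε →
      IntegrableOn (fun x => f x * (Real.exp (-(x * ε)) : ℂ)) (Ioi a)) :
    Tendsto (fun ε : ℝ => ∫ x in Ioi a, f x * (Real.exp (-(x * ε)) : ℂ)) (𝓝[>] 0) (𝓝 I) := by
  obtain ⟨M, hM⟩ := h.exists_norm_primitive_le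
  -- With s = a + v/ε the weight is the fixed density exp(-v), and the bounded primitive is
  -- evaluated at a point tending to infinity.
  have key : ∀ᶠ ε : ℝ in 𝓝[>] 0, (Real.exp (-(a * ε)) : ℂ) * ∫ v in Ioi (0 : ℝ),
      (Real.exp (-v) : ℂ) * ∫ x in a..(a + ε⁻¹ * v), f x =
      ∫ x in Ioi a, f x * (Real.exp (-(x * ε)) : ℂ) := by
    filter_upwards [self_mem_nhdsWithin] with ε hε
    have hε' : 0 < ε := hε
    rw [integral_mul_exp_eq hε (hint ε hε), ← integral_Ioi_comp_add_left _ a]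
    have := integral_comp_mul_left_Ioi (fun u => ((ε * Real.exp (-((a + u) * ε)) : ℝ) : ℂ) *
      ∫ x in a..(a + u), f x) 0 (inv_pos.2 hε)
    rw [mul_zero, inv_inv, Complex.real_smul, eq_comm,
      ← eq_inv_mul_iff_mul_eq₀ (by exact_mod_cast hε'.ne')] at this
    rw [this, ← integral_const_mul, ← integral_const_mul]
    congr 1
    ext v
    have e : Real.exp (-((a + ε⁻¹ * v) * ε)) = Real.exp (-(a * ε)) * Real.exp (-v) := by
      rw [← Real.exp_add]
      congr 1
      field_simp
      ring
    have hεc : (ε : ℂ) ≠ 0 := by exact_mod_cast hε'.ne'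
    rw [e]
    push_cast
    field_simp
  refine Tendsto.congr' key ?_
  have h1 : Tendsto (fun ε : ℝ => (Real.exp (-(a * ε)) : ℂ)) (𝓝[>] 0) (𝓝 1) := by
    have : Continuous fun ε : ℝ => (Real.exp (-(a * ε)) : ℂ) := by fun_prop
    simpa using (this.tendsto 0).mono_left nhdsWithin_le_nhds
  have h2 : ∫ v in Ioi (0 : ℝ), (Real.exp (-v) : ℂ) * I = I := by
    rw [integral_mul_const, integral_complex_ofReal, integral_exp_neg_Ioi_zero]
    simp
  have h3 : Tendsto (fun ε : ℝ => ∫ v in Ioi (0 : ℝ),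
      (Real.exp (-v) : ℂ) * ∫ x in a..(a + ε⁻¹ * v), f x) (𝓝[>] 0)
      (𝓝 (∫ v in Ioi (0 : ℝ), (Real.exp (-v) : ℂ) * I)) := by
    refine tendsto_integral_filter_of_dominated_convergence
      (fun v : ℝ => Real.exp (-v) * M) ?_ ?_ ?_ ?_
    · filter_upwards [self_mem_nhdsWithin] with ε hε
      have hε' : 0 < ε := hε
      refine ContinuousOn.aestronglyMeasurable (ContinuousOn.mul (by fun_prop) ?_) measurableSet_Ioi
      refine h.continuousOn_primitive.comp (t := Ici a) (by fun_prop) fun v hv => ?_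
      have hv' : 0 < v := hv
      have : 0 < ε⁻¹ * v := by positivity
      simp only [mem_Ici]
      linarith
    · filter_upwards [self_mem_nhdsWithin] with ε hε
      have hε' : 0 < ε := hε
      filter_upwards [ae_restrict_mem measurableSet_Ioi] with v hv
      have hv' : 0 < v := hv
      have : 0 < ε⁻¹ * v := by positivity
      rw [norm_mul, Complex.norm_real, Real.norm_of_nonneg (Real.exp_pos _).le]
      exact mul_le_mul_of_nonneg_left (hM _ (by linarith)) (Real.exp_pos _).le
    · exact (integrableOn_exp_neg_Ioi 0).mul_const M
    · filter_upwards [ae_restrict_mem measurableSet_Ioi] with v hv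
      have hv' : 0 < v := hv
      refine Tendsto.const_mul _ (h.2.comp ?_)
      exact tendsto_atTop_add_const_left _ _ (tendsto_inv_nhdsGT_zero.atTop_mul_const hv')
  have h4 := h1.mul h3
  rwa [h2, one_mul] at h4

end HasImproperIntegral

/-! ### Exchanging integrals and removing the damping -/

/-- The closed form of the Laplace transform of `besselWeight μ p β` at `s`, as an integral over
the whole line; it is continuous and bounded in `s`. -/
noncomputable def besselWeightLaplace (μ : ℂ) (p β s : ℝ) : ℂ :=
  ((√(2 / Real.pi) : ℝ) : ℂ) * (p : ℂ) ^ (μ + 1 / 2) * (β : ℂ) ^ μ * (1 / 2) *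
    ∫ u : ℝ, (Real.exp (-(p / 2 * (s ^ 2 + β ^ 2) * Real.exp u + p / 2 * Real.exp (-u))) : ℂ) *
      Complex.exp ((μ + 1 / 2) * u)

theorem besselWeightLaplace_mul (μ : ℂ) {p β : ℝ} (hp : 0 < p) (hβ : 0 < β) (G : ℝ → ℂ) (t : ℝ) :
    besselWeightLaplace μ p β t * G t = ((√(2 / Real.pi) : ℝ) : ℂ) * (p : ℂ) ^ (μ + 1 / 2) *
      (β : ℂ) ^ μ * tIntegrand μ p β G t := by
  have := half_mul_integral_eq_besselK μ t hp hβ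
  rw [besselWeightLaplace, tIntegrand, mul_assoc _ (1 / 2 : ℂ), this]
  ring

theorem norm_exp_neg_sq_add_sq_le (μ : ℂ) {p : ℝ} (β s u : ℝ) (hp : 0 < p) :
    ‖(Real.exp (-(p / 2 * (s ^ 2 + β ^ 2) * Real.exp u + p / 2 * Real.exp (-u))) : ℂ) *
      Complex.exp ((μ + 1 / 2) * u)‖ ≤
    ‖(Real.exp (-(p / 2 * β ^ 2 * Real.exp u + p / 2 * Real.exp (-u))) : ℂ) *
      Complex.exp ((μ + 1 / 2) * u)‖ := by
  rw [norm_mul, norm_mul, Complex.norm_real, Complex.norm_real,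
    Real.norm_of_nonneg (Real.exp_pos _).le, Real.norm_of_nonneg (Real.exp_pos _).le]
  gcongr
  nlinarith [sq_nonneg s]

theorem continuous_besselWeightLaplace (μ : ℂ) {p β : ℝ} (hp : 0 < p) (hβ : 0 < β) :
    Continuous (besselWeightLaplace μ p β) := by
  refine continuous_const.mul (continuous_of_dominated (fun s => ?_)
    (fun s => ae_of_all _ fun u => norm_exp_neg_sq_add_sq_le μ β s u hp)
    (integrable_exp_neg_mul_exp_add_mul_exp_neg (by positivity) (by positivity) _).norm
    (ae_of_all _ fun u => by fun_prop))
  exact Continuous.aestronglyMeasurable (by fun_prop)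

theorem exists_norm_besselWeightLaplace_le (μ : ℂ) {p β : ℝ} (hp : 0 < p) (hβ : 0 < β) :
    ∃ M : ℝ, 0 ≤ M ∧ ∀ s, ‖besselWeightLaplace μ p β s‖ ≤ M := by
  suffices h : ∃ M : ℝ, ∀ s, ‖besselWeightLaplace μ p β s‖ ≤ M by
    obtain ⟨M, hM⟩ := h
    exact ⟨M, (norm_nonneg _).trans (hM 0), hM⟩
  refine ⟨‖((√(2 / Real.pi) : ℝ) : ℂ) * (p : ℂ) ^ (μ + 1 / 2) * (β : ℂ) ^ μ * (1 / 2)‖ *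
    ∫ u : ℝ, ‖(Real.exp (-(p / 2 * β ^ 2 * Real.exp u + p / 2 * Real.exp (-u))) : ℂ) *
      Complex.exp ((μ + 1 / 2) * u)‖, fun s => ?_⟩
  rw [besselWeightLaplace, norm_mul]
  exact mul_le_mul_of_nonneg_left (norm_integral_le_of_norm_le
    (integrable_exp_neg_mul_exp_add_mul_exp_neg (a := p / 2 * β ^ 2) (by positivity)
      (half_pos hp) (μ + 1 / 2)).norm
    (ae_of_all _ fun u => norm_exp_neg_sq_add_sq_le μ β s u hp)) (norm_nonneg _)

theorem laplace_norm_besselWeight_antitone {μ : ℂ} (hμ : -1 < μ.re) {p β s t : ℝ} (hp : 0 < p)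
    (hβ : 0 < β) (hs : 0 < s) (hst : s ≤ t) :
    ∫ x in Ioi p, ‖besselWeight μ p β x * (Real.exp (-(x * t)) : ℂ)‖ ≤
      ∫ x in Ioi p, ‖besselWeight μ p β x * (Real.exp (-(x * s)) : ℂ)‖ := by
  refine setIntegral_mono_on
    (integrableOn_besselWeight_mul_exp hμ hp hβ (hs.trans_le hst)).norm
    (integrableOn_besselWeight_mul_exp hμ hp hβ hs).norm measurableSet_Ioi fun x hx => ?_
  have hx0 : 0 < x := hp.trans hx
  rw [norm_mul, norm_mul, Complex.norm_real, Complex.norm_real,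
    Real.norm_of_nonneg (Real.exp_pos _).le, Real.norm_of_nonneg (Real.exp_pos _).le]
  gcongr

/-- Measurability of G is not assumed; it is recovered by undoing the exponential factor at the
point p + 1. -/
theorem IsLaplaceTransformOn.aestronglyMeasurable {F G : ℝ → ℂ} {p : ℝ}
    (h : IsLaplaceTransformOn F G p) : AEStronglyMeasurable G (volume.restrict (Ioi 0)) := by
  have h1 : AEStronglyMeasurable (fun t : ℝ => (Real.exp ((p + 1) * t) : ℂ))
    (volume.restrict (Ioi 0)) := Measurable.aestronglyMeasurable (by fun_prop)
  refine (h1.mul (h (p + 1) (by linarith)).1.aestronglyMeasurable).congr (ae_of_all _ fun t => ?_)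
  simp only [Pi.mul_apply]
  rw [← mul_assoc, ← Complex.ofReal_mul, ← Real.exp_add]
  simp

theorem IsLaplaceTransformOn.integrableOn_Ioc {F G : ℝ → ℂ} {p : ℝ}
    (h : IsLaplaceTransformOn F G p) (hp : 0 < p) (T : ℝ) : IntegrableOn G (Ioc 0 T) := by
  have h1 := (h (p + 1) (by linarith)).1.mono_set (Ioc_subset_Ioi_self : Ioc 0 T ⊆ Ioi 0)
  refine (h1.norm.const_mul (Real.exp ((p + 1) * T))).mono'
    (h.aestronglyMeasurable.mono_set Ioc_subset_Ioi_self) ?_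
  filter_upwards [ae_restrict_mem measurableSet_Ioc] with t ht
  rw [norm_mul, Complex.norm_real, Real.norm_of_nonneg (Real.exp_pos _).le, ← mul_assoc,
    ← Real.exp_add]
  refine le_mul_of_one_le_left (norm_nonneg _) (Real.one_le_exp ?_)
  nlinarith [ht.2]

theorem IsLaplaceTransformOn.integrableOn_indicator {F G : ℝ → ℂ} {p : ℝ}
    (h : IsLaplaceTransformOn F G p) (hp : 0 < p) (T M : ℝ) :
    IntegrableOn ((Ioc 0 T).indicator fun t => M * ‖G t‖) (Ioi 0) := by
  rw [IntegrableOn, integrable_indicator_iff measurableSet_Ioc, IntegrableOn,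
    Measure.restrict_restrict measurableSet_Ioc, inter_eq_left.2 Ioc_subset_Ioi_self]
  exact (h.integrableOn_Ioc hp T).norm.const_mul M

theorem integrableOn_xIntegrand_mul_exp_and_integral_eq {μ : ℂ} (hμ : -1 < μ.re) {p β : ℝ}
    (hp : 0 < p) (hβ : 0 < β) {F G : ℝ → ℂ} (hFG : IsLaplaceTransformOn F G p)
    (hG : IntegrableOn (fun t => besselWeightLaplace μ p β t * G t) (Ioi 0)) {ε : ℝ}
    (hε : 0 < ε) :
    IntegrableOn (fun x => xIntegrand μ p β F x * (Real.exp (-(x * ε)) : ℂ)) (Ioi p) ∧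
    ∫ x in Ioi p, xIntegrand μ p β F x * (Real.exp (-(x * ε)) : ℂ) =
      ∫ t in Ioi (0 : ℝ), besselWeightLaplace μ p β (t + ε) * G t := by
  obtain ⟨C, T, hC, hT, hCT⟩ := exists_laplace_norm_besselWeight_le hμ hp hβ
  have hlap : ∀ s : ℝ, 0 < s → ∫ x in Ioi p, besselWeight μ p β x * (Real.exp (-(x * s)) : ℂ) =
      besselWeightLaplace μ p β s := fun s hs => integral_besselWeight_mul_exp hμ hp hβ hs
  set H : ℝ → ℝ → ℂ := fun x t =>
    besselWeight μ p β x * (Real.exp (-(x * (t + ε))) : ℂ) * G t with hH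
  have hGm := hFG.aestronglyMeasurable
  have hWm := measurable_besselWeight hμ p β
  have hHm : AEStronglyMeasurable (Function.uncurry H)
      ((volume.restrict (Ioi p)).prod (volume.restrict (Ioi 0))) := by
    have h1 : AEStronglyMeasurable
        (fun z : ℝ × ℝ => besselWeight μ p β z.1 * (Real.exp (-(z.1 * (z.2 + ε))) : ℂ))
        ((volume.restrict (Ioi p)).prod (volume.restrict (Ioi 0))) :=
      Measurable.aestronglyMeasurable (by fun_prop)
    exact h1.mul hGm.comp_snd
  have hHint : Integrable (Function.uncurry H)
      ((volume.restrict (Ioi p)).prod (volume.restrict (Ioi 0))) := by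
    rw [integrable_prod_iff' hHm]
    constructor
    · filter_upwards [ae_restrict_mem measurableSet_Ioi] with t ht
      have ht' : 0 < t := ht
      have h := integrableOn_besselWeight_mul_exp hμ hp hβ (add_pos ht' hε)
      exact Integrable.mul_const h (G t)
    · set m := ∫ x in Ioi p, ‖besselWeight μ p β x * (Real.exp (-(x * ε)) : ℂ)‖ with hm
      refine ((hFG.integrableOn_indicator hp T m).add (hG.norm.const_mul C)).mono'
        hHm.norm.prod_swap.integral_prod_right' ?_
      filter_upwards [ae_restrict_mem measurableSet_Ioi] with t ht
      have ht' : 0 < t := ht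
      have e : ∫ x in Ioi p, ‖Function.uncurry H (x, t)‖ =
          (∫ x in Ioi p, ‖besselWeight μ p β x * (Real.exp (-(x * (t + ε))) : ℂ)‖) * ‖G t‖ := by
        rw [← integral_mul_const]
        congr 1
        ext x
        simp only [Function.uncurry, hH, norm_mul]
      rw [Real.norm_of_nonneg (integral_nonneg fun x => norm_nonneg _), e, Pi.add_apply]
      have hm0 : 0 ≤ m := integral_nonneg fun x => norm_nonneg _
      -- Up to T, monotonicity compares with the finite value at ε, and G is locally integrable.
      -- Beyond T, it compares with the value at t, which is at most C times the modulus of the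
      -- transform.
      by_cases htT : t ≤ T
      · rw [indicator_of_mem (show t ∈ Ioc 0 T from ⟨ht', htT⟩)]
        refine le_add_of_le_of_nonneg ?_ (by positivity)
        exact mul_le_mul_of_nonneg_right
          (laplace_norm_besselWeight_antitone hμ hp hβ hε (by linarith)) (norm_nonneg _)
      · rw [indicator_of_notMem (fun h => htT h.2), zero_add, norm_mul, ← mul_assoc, ← hlap t ht']
        refine mul_le_mul_of_nonneg_right ?_ (norm_nonneg _)
        exact (laplace_norm_besselWeight_antitone hμ hp hβ ht' (by linarith)).trans
          (hCT t (not_le.1 htT).le)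
  have e1 : ∀ x ∈ Ioi p, ∫ t in Ioi (0 : ℝ), H x t =
      xIntegrand μ p β F x * (Real.exp (-(x * ε)) : ℂ) := by
    intro x hx
    rw [xIntegrand, ← besselWeight, (hFG x hx).2, mul_right_comm, ← integral_const_mul]
    congr 1
    ext t
    simp only [hH]
    rw [mul_add, neg_add, Real.exp_add]
    push_cast
    ring
  have e2 : ∀ t ∈ Ioi (0 : ℝ), ∫ x in Ioi p, H x t = besselWeightLaplace μ p β (t + ε) * G t := by
    intro t ht
    have ht' : 0 < t := ht
    simp only [hH]
    rw [integral_mul_const, hlap _ (by positivity)]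
  constructor
  · refine IntegrableOn.congr_fun (f := fun x => ∫ t in Ioi (0 : ℝ), H x t) ?_ e1
      measurableSet_Ioi
    exact hHint.integral_prod_left
  · rw [← setIntegral_congr_fun measurableSet_Ioi e1, integral_integral_swap hHint,
      setIntegral_congr_fun measurableSet_Ioi e2]

theorem tendsto_integral_besselWeightLaplace_add {μ : ℂ} (hμ : -1 < μ.re) {p β : ℝ}
    (hp : 0 < p) (hβ : 0 < β) {F G : ℝ → ℂ} (hFG : IsLaplaceTransformOn F G p)
    (hG : IntegrableOn (fun t => besselWeightLaplace μ p β t * G t) (Ioi 0)) :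
    Tendsto (fun ε : ℝ => ∫ t in Ioi (0 : ℝ), besselWeightLaplace μ p β (t + ε) * G t) (𝓝[>] 0)
      (𝓝 (∫ t in Ioi (0 : ℝ), besselWeightLaplace μ p β t * G t)) := by
  obtain ⟨C, T, hC, hT, hCT⟩ := exists_laplace_norm_besselWeight_le hμ hp hβ
  obtain ⟨M, hM0, hM⟩ := exists_norm_besselWeightLaplace_le μ hp hβ
  have hlap : ∀ s : ℝ, 0 < s → ∫ x in Ioi p, besselWeight μ p β x * (Real.exp (-(x * s)) : ℂ) =
      besselWeightLaplace μ p β s := fun s hs => integral_besselWeight_mul_exp hμ hp hβ hs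
  have hcont := continuous_besselWeightLaplace μ hp hβ
  refine tendsto_integral_filter_of_dominated_convergence _ ?_ ?_
    ((hFG.integrableOn_indicator hp T M).add (hG.norm.const_mul C)) ?_
  · exact Eventually.of_forall fun ε =>
      (Continuous.aestronglyMeasurable (by fun_prop)).mul hFG.aestronglyMeasurable
  · filter_upwards [self_mem_nhdsWithin] with ε hε
    have hε' : 0 < ε := hε
    filter_upwards [ae_restrict_mem measurableSet_Ioi] with t ht
    have ht' : 0 < t := ht
    rw [Pi.add_apply, norm_mul]
    -- The majorant must now be independent of ε, so up to T the bound on the closed form replaces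
    -- the value at ε used for Fubini, which may blow up as ε → 0.
    by_cases htT : t ≤ T
    · rw [indicator_of_mem (show t ∈ Ioc 0 T from ⟨ht', htT⟩)]
      refine le_add_of_le_of_nonneg ?_ (by positivity)
      exact mul_le_mul_of_nonneg_right (hM _) (norm_nonneg _)
    · rw [indicator_of_notMem (fun h => htT h.2), zero_add, norm_mul, ← mul_assoc, ← hlap t ht',
        ← hlap (t + ε) (by positivity)]
      refine mul_le_mul_of_nonneg_right ?_ (norm_nonneg _)
      exact (norm_integral_le_integral_norm _).trans
        ((laplace_norm_besselWeight_antitone hμ hp hβ ht' (by linarith)).trans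
          (hCT t (not_le.1 htT).le))
  · refine ae_of_all _ fun t => Tendsto.mul_const _ ?_
    have : Continuous fun ε : ℝ => besselWeightLaplace μ p β (t + ε) := by fun_prop
    simpa using (this.tendsto 0).mono_left nhdsWithin_le_nhds

theorem mainTheorem4 (μ : ℂ) (hμ : -1 < μ.re) (p β : ℝ) (hp : 0 < p) (hβ : 0 < β)
    (F G : ℝ → ℂ) (hFG : IsLaplaceTransformOn F G p)
    (hG : IntegrableOn (tIntegrand μ p β G) (Ioi 0) volume) :
    (∀ I : ℂ, HasImproperIntegral (xIntegrand μ p β F) p I ↔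
      HasImproperIntegral (yIntegrand μ p β F) 0 I) ∧
    ((∃ I : ℂ, HasImproperIntegral (xIntegrand μ p β F) p I) →
      HasImproperIntegral (xIntegrand μ p β F) p
        (((√(2 / Real.pi) : ℝ) : ℂ) * (p : ℂ) ^ (μ + 1 / 2) * (β : ℂ) ^ μ *
          ∫ t in Ioi (0 : ℝ), tIntegrand μ p β G t) ∧
      HasImproperIntegral (yIntegrand μ p β F) 0
        (((√(2 / Real.pi) : ℝ) : ℂ) * (p : ℂ) ^ (μ + 1 / 2) * (β : ℂ) ^ μ *
          ∫ t in Ioi (0 : ℝ), tIntegrand μ p β G t)) := by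
  have hiff := hasImproperIntegral_xIntegrand_iff μ β F hp
  refine ⟨hiff, ?_⟩
  rintro ⟨I, hI⟩
  rw [← hiff, and_self]
  have hG' : IntegrableOn (fun t => besselWeightLaplace μ p β t * G t) (Ioi 0) := by
    simp only [besselWeightLaplace_mul μ hp hβ]
    exact hG.const_mul _
  have habel := hI.tendsto_integral_mul_exp fun ε hε =>
    (integrableOn_xIntegrand_mul_exp_and_integral_eq hμ hp hβ hFG hG' hε).1
  have hlim := tendsto_integral_besselWeightLaplace_add hμ hp hβ hFG hG'
  -- Both sides are limits of the same damped integrals as ε → 0+, by Abel's theorem and by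
  -- dominated convergence.
  have heq : I = ∫ t in Ioi (0 : ℝ), besselWeightLaplace μ p β t * G t := by
    refine tendsto_nhds_unique habel (hlim.congr' ?_)
    filter_upwards [self_mem_nhdsWithin] with ε hε
    exact (integrableOn_xIntegrand_mul_exp_and_integral_eq hμ hp hβ hFG hG' hε).2.symm
  simp only [besselWeightLaplace_mul μ hp hβ] at heq
  rw [integral_const_mul] at heq
  rwa [← heq]
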